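/- Let $F$ be Thompson's group of strictly increasing piecewise linear homeomorphisms of $[0,1]$ with finitely many break points, all of them dyadic rationals, and with slopes integer powers of $2$. Let $x_0,x_1\in F$ be the generators $$x_0(t)=\begin{cases} t/2,&0\le t\le \frac12\\ t-\frac14,&\frac12\le t\le\frac34\\ 2t-1,&\frac34\le t\le 1\end{cases}\qquad x_1(t)=\begin{cases} t,&0\le t\le\frac12\\ \frac t2+\frac14,&\frac12\le t\le\frac34\\ t-\frac18,&\frac34\le t\le\frac78\\ 2t-1,&\frac78\le t\le1.\end{cases}$$ For $q\in[0,1]$ let $\Gamma_q$ be the pointed Schreier graph of the action of $F$ on the orbit of $q$: its vertices are the points of the orbit, there is an edge labeled $x_i$ from $y$ to $x_i(y)$ for all $y$ and $i\in\{0,1\}$, and $q$ is the base vertex. Consider the space of connected pointed oriented graphs with edges labeled by $x_0,x_1$, in which each vertex has exactly one outgoing and one incoming edge of each label, up to isomorphism of pointed labeled graphs. The distance of two graphs is $2^{-n}$, where $n$ is the largest integer such that the balls of radius $n$ around the base vertices are isomorphic as pointed labeled graphs (the distance is $0$ if all these balls are isomorphic, and $n=-1$ if even the balls of radius $0$ are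 not). Let $\mathcal C=\{\Gamma_q : q \text{ a dyadic rational},\ 0<q<1\}$. For an infinite word $w=w_0w_1w_2\ldots$ over $\{0,1\}$ let $T_w$ be the following labeled graph. Its grey vertices form a binary tree without root, in which every grey vertex has a $0$-child, a $1$-child and a parent: there is an infinite upward path $s_0,s_1,s_2,\ldots$ such that $s_k$ is the $w_k$-child of $s_{k+1}$ (so the path turns left or right at each level as the letter of $w$ is $0$ or $1$), and full binary trees hang below $s_0$ and below the other child of each $s_{k+1}$. Each grey vertex $g$ lies on a line of vertices $(g,j)$, $j\in\mathbb Z$, with $(g,0)=g$, and these are all the vertices of $T_w$. The edge labeled $x_0$ goes from $(g,j)$ to $(g,j+1)$. The edge labeled $x_1$ that starts at $(g,j)$ is a loop if $j\ge1$, ends at the $0$-child of $g$ if $j=0$, ends at the $1$-child of $g$ if $j=-1$, and ends at $(g,j+1)$ if $j\le-2$. For $n\ge1$ let $\tilde\Gamma_{1^n0w}$ and $\tilde\Gamma_{0^n1w}$ be the graph $T_w$ with base vertex $(s_0,1-n)$ and $(s_0,n)$, respectively. Let $\tilde\Gamma_{0^\infty}$ and $\tilde\Gamma_{1^\infty}$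 be the graphs with vertex set $\mathbb Z$, base vertex $0$, and edges labeled $x_0$ from $j$ to $j+1$ for all $j$; the edges labeled $x_1$ are a loop at each $j$ in $\tilde\Gamma_{0^\infty}$, and go from $j$ to $j+1$ for all $j$ in $\tilde\Gamma_{1^\infty}$. **Proposition.** Up to isomorphism of pointed labeled graphs, the closure $\overline{\mathcal C}$ consists exactly of the following graphs: A. the Schreier graph of the action of $F$ on the orbit of $\frac12$ with any vertex as base vertex; B. the graphs $\tilde\Gamma_{1^n0w}$ and $\tilde\Gamma_{0^n1w}$ for all $n\ge1$ and $w\in\{0,1\}^{\mathbb N}$; C. the two graphs $\tilde\Gamma_{0^\infty}$ and $\tilde\Gamma_{1^\infty}$. Moreover, if $\xi\ne\eta$ are infinite words over $\{0,1\}$, then $\tilde\Gamma_\xi$ and $\tilde\Gamma_\eta$ are not isomorphic as pointed labeled graphs. -/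

import Mathlib

namespace ThompsonSchreier

open Set Filter Topology
open scoped unitInterval

/-! ### Dyadic rationals and Thompson's group `F` -/

/-- `t` is a dyadic rational number. -/
def IsDyadic (t : ℝ) : Prop := ∃ (a : ℤ) (n : ℕ), t = a / 2 ^ n

theorem IsDyadic.add {s t : ℝ} (hs : IsDyadic s) (ht : IsDyadic t) : IsDyadic (s + t) := by
  obtain ⟨a, n, rfl⟩ := hs
  obtain ⟨b, m, rfl⟩ := ht
  refine ⟨a * 2 ^ m + b * 2 ^ n, n + m, ?_⟩
  push_cast
  field_simp
  ring

theorem IsDyadic.neg {t : ℝ} (ht : IsDyadic t) : IsDyadic (-t) := by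
  obtain ⟨b, m, rfl⟩ := ht
  exact ⟨-b, m, by push_cast; ring⟩

theorem IsDyadic.sub {s t : ℝ} (hs : IsDyadic s) (ht : IsDyadic t) : IsDyadic (s - t) := by
  rw [sub_eq_add_neg]
  exact hs.add ht.neg

theorem IsDyadic.zpow_mul (k : ℤ) {t : ℝ} (ht : IsDyadic t) : IsDyadic (2 ^ k * t) := by
  obtain ⟨b, m, rfl⟩ := ht
  rcases Int.eq_nat_or_neg k with ⟨n, rfl | rfl⟩
  · exact ⟨b * 2 ^ n, m, by push_cast; rw [zpow_natCast]; ring⟩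
  · exact ⟨b, n + m, by rw [zpow_neg, zpow_natCast, pow_add]; field_simp⟩

theorem isDyadic_zpow_mul_iff (k : ℤ) {t : ℝ} : IsDyadic (2 ^ k * t) ↔ IsDyadic t := by
  refine ⟨fun h => ?_, IsDyadic.zpow_mul k⟩
  have := h.zpow_mul (-k)
  rwa [← mul_assoc, ← zpow_add₀ (by norm_num : (2 : ℝ) ≠ 0), neg_add_cancel, zpow_zero,
    one_mul] at this

/-- A strictly increasing bijection `f` of `[0,1]` (such an `f` is automatically a homeomorphism)
is piecewise linear, with slopes integer powers of `2` and with finitely many break points, all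
of them dyadic: outside a finite set `D` of dyadic rationals, `f` is locally of the form
`s ↦ 2 ^ k * s + c`. -/
def IsDyadicPL (f : I ≃o I) : Prop :=
  ∃ D : Finset I, (∀ d ∈ D, IsDyadic d) ∧
    ∀ t ∉ D, ∃ (k : ℤ) (c : ℝ), ∀ᶠ s in 𝓝 t, (f s : ℝ) = 2 ^ k * (s : ℝ) + c

theorem hasDerivAt_extend {f : I ≃o I} {t : ℝ} (ht : t ∈ Ioo (0 : ℝ) 1) {k : ℤ} {c : ℝ}
    (h : ∀ᶠ s in 𝓝 (⟨t, Ioo_subset_Icc_self ht⟩ : I), (f s : ℝ) = 2 ^ k * (s : ℝ) + c) :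
    HasDerivAt (fun s : ℝ => (f (projIcc 0 1 zero_le_one s) : ℝ)) (2 ^ k) t := by
  have h1 : projIcc (0 : ℝ) 1 zero_le_one t = ⟨t, Ioo_subset_Icc_self ht⟩ :=
    projIcc_of_mem _ _
  have h2 : ∀ᶠ s in 𝓝 t, (f (projIcc 0 1 zero_le_one s) : ℝ)
      = 2 ^ k * ((projIcc 0 1 zero_le_one s : I) : ℝ) + c := by
    have hc : Tendsto (projIcc (0 : ℝ) 1 zero_le_one) (𝓝 t)
        (𝓝 (⟨t, Ioo_subset_Icc_self ht⟩ : I)) := by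
      rw [← h1]; exact continuous_projIcc.continuousAt
    exact hc.eventually h
  have h3 : (fun s : ℝ => (f (projIcc 0 1 zero_le_one s) : ℝ)) =ᶠ[𝓝 t]
      fun s => 2 ^ k * s + c := by
    filter_upwards [h2, isOpen_Ioo.mem_nhds ht] with s hs hs'
    rw [hs, projIcc_of_mem _ (Ioo_subset_Icc_self hs')]
  refine HasDerivAt.congr_of_eventuallyEq ?_ h3
  simpa using ((hasDerivAt_id t).const_mul ((2 : ℝ) ^ k)).add_const c

theorem IsDyadicPL.isDyadic_iff {f : I ≃o I} (hf : IsDyadicPL f) (t : I) :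
    IsDyadic (f t) ↔ IsDyadic t := by
  obtain ⟨D, hD, hloc⟩ := hf
  have zero_dy : IsDyadic 0 := ⟨0, 0, by simp⟩
  have key : ∀ (n : ℕ) (t : I), (D.filter (· < t)).card = n →
      (IsDyadic (f t) ↔ IsDyadic t) := by
    intro n
    induction n using Nat.strong_induction_on with
    | _ n ih =>
      intro t hn
      rcases eq_or_lt_of_le (unitInterval.nonneg' : (0 : I) ≤ t) with h0 | h0
      · subst h0
        have : f 0 = 0 := f.map_bot
        rw [this]
      -- the largest break point below `t`, or `0`
      obtain ⟨d, hdt, hd, hfd, hmax⟩ : ∃ d : I, d < t ∧ IsDyadic d ∧ IsDyadic (f d) ∧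
          ∀ s, d < s → s < t → s ∉ D := by
        by_cases hne : (D.filter (· < t)).Nonempty
        · obtain ⟨d, hdm, hdmax⟩ := Finset.exists_max_image _ id hne
          rw [Finset.mem_filter] at hdm
          have hlt : (D.filter (· < d)).card < n := by
            rw [← hn]
            apply Finset.card_lt_card
            refine Finset.ssubset_iff_subset_ne.2 ⟨fun x hx => ?_, fun he => ?_⟩
            · rw [Finset.mem_filter] at hx ⊢
              exact ⟨hx.1, hx.2.trans hdm.2⟩
            · have : d ∈ D.filter (· < d) := by
                rw [he, Finset.mem_filter]; exact hdm
              simp at this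
          refine ⟨d, hdm.2, hD d hdm.1, (ih _ hlt d rfl).2 (hD d hdm.1), fun s h1 h2 h3 => ?_⟩
          exact absurd (hdmax s (Finset.mem_filter.2 ⟨h3, h2⟩)) (not_le.2 h1)
        · refine ⟨0, h0, zero_dy, ?_, fun s _ h2 h3 => ?_⟩
          · have : f 0 = 0 := f.map_bot
            rw [this]; exact zero_dy
          · exact hne ⟨s, Finset.mem_filter.2 ⟨h3, h2⟩⟩
      have hIoo : ∀ s ∈ Ioo (d : ℝ) t, s ∈ Ioo (0 : ℝ) 1 := fun s hs =>
        ⟨lt_of_le_of_lt d.2.1 hs.1, lt_of_lt_of_le hs.2 t.2.2⟩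
      have hex : ∀ s ∈ Ioo (d : ℝ) t, ∃ k : ℤ,
          HasDerivAt (fun s : ℝ => (f (projIcc 0 1 zero_le_one s) : ℝ)) (2 ^ k) s := by
        intro s hs
        obtain ⟨k, c, h⟩ := hloc ⟨s, Ioo_subset_Icc_self (hIoo s hs)⟩ (hmax _ hs.1 hs.2)
        exact ⟨k, hasDerivAt_extend (hIoo s hs) h⟩
      have hcont : Continuous (fun s : ℝ => (f (projIcc 0 1 zero_le_one s) : ℝ)) :=
        continuous_subtype_val.comp (f.continuous.comp continuous_projIcc)
      obtain ⟨m, hm, hslope⟩ := exists_deriv_eq_slope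
        (fun s : ℝ => (f (projIcc 0 1 zero_le_one s) : ℝ)) hdt hcont.continuousOn
        (fun s hs => (hex s hs).choose_spec.differentiableAt.differentiableWithinAt)
      obtain ⟨k, hk⟩ := hex m hm
      rw [hk.deriv] at hslope
      simp only [projIcc_val] at hslope
      have hpos : (t : ℝ) - d ≠ 0 := sub_ne_zero.2 (ne_of_gt hdt)
      have heq : (f t : ℝ) = f d + 2 ^ k * ((t : ℝ) - d) := by
        rw [hslope]; field_simp; ring
      constructor
      · intro h
        have h1 : IsDyadic ((2 : ℝ) ^ k * ((t : ℝ) - d)) := by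
          have := h.sub hfd
          rw [heq] at this
          simpa using this
        have := ((isDyadic_zpow_mul_iff k).1 h1).add hd
        simpa using this
      · intro h
        rw [heq]
        exact hfd.add ((h.sub hd).zpow_mul k)
  exact key _ t rfl

/-- Thompson's group `F`, with composition of maps as group operation. -/
def thompsonF : Subgroup (I ≃o I) where
  carrier := {f | IsDyadicPL f}
  one_mem' := ⟨∅, by simp, fun t _ => ⟨0, 0, by simp⟩⟩
  mul_mem' := by
    intro f g hf hg
    have hg' := hg
    obtain ⟨D, hD, hf⟩ := hf
    obtain ⟨E, hE, hg⟩ := hg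
    classical
    refine ⟨E ∪ D.image g.symm, fun d hd => ?_, fun t ht => ?_⟩
    · rcases Finset.mem_union.1 hd with h | h
      · exact hE d h
      · obtain ⟨e, he, rfl⟩ := Finset.mem_image.1 h
        rw [← hg'.isDyadic_iff, OrderIso.apply_symm_apply]
        exact hD e he
    · rw [Finset.mem_union, not_or] at ht
      obtain ⟨k, c, h⟩ := hg t ht.1
      obtain ⟨l, e, h'⟩ := hf (g t) (fun h => ht.2 (Finset.mem_image.2 ⟨_, h, by simp⟩))
      refine ⟨l + k, 2 ^ l * c + e, ?_⟩
      filter_upwards [h, g.continuous.continuousAt.eventually h'] with s h1 h2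
      change (f (g s) : ℝ) = _
      rw [h2, h1, zpow_add₀ (by norm_num)]
      ring
  inv_mem' := by
    intro f hf
    have hf' := hf
    obtain ⟨D, hD, hf⟩ := hf
    classical
    refine ⟨D.image f, fun d hd => ?_, fun t ht => ?_⟩
    · obtain ⟨e, he, rfl⟩ := Finset.mem_image.1 hd
      exact (hf'.isDyadic_iff e).2 (hD e he)
    · obtain ⟨k, c, h⟩ := hf (f.symm t) (fun h => ht (Finset.mem_image.2 ⟨_, h, by simp⟩))
      refine ⟨-k, -(2 ^ (-k) * c), ?_⟩
      filter_upwards [f.symm.continuous.continuousAt.eventually h] with s h1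
      change (f.symm s : ℝ) = _
      rw [OrderIso.apply_symm_apply] at h1
      rw [h1, mul_add, ← mul_assoc, ← zpow_add₀ (by norm_num : (2 : ℝ) ≠ 0)]
      simp

/-! ### The generators `x₀` and `x₁` -/

/-- The formula of `x₀` on `[0,1]`. -/
noncomputable def x0Fun (t : ℝ) : ℝ :=
  if t ≤ 1 / 2 then t / 2 else if t ≤ 3 / 4 then t - 1 / 4 else 2 * t - 1

/-- The formula of `x₁` on `[0,1]`. -/
noncomputable def x1Fun (t : ℝ) : ℝ :=
  if t ≤ 1 / 2 then t else if t ≤ 3 / 4 then t / 2 + 1 / 4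
  else if t ≤ 7 / 8 then t - 1 / 8 else 2 * t - 1

/-- The inverse of `x0Fun`. -/
noncomputable def x0Inv (t : ℝ) : ℝ :=
  if t ≤ 1 / 4 then 2 * t else if t ≤ 1 / 2 then t + 1 / 4 else (t + 1) / 2

/-- The inverse of `x1Fun`. -/
noncomputable def x1Inv (t : ℝ) : ℝ :=
  if t ≤ 1 / 2 then t else if t ≤ 5 / 8 then 2 * t - 1 / 2
  else if t ≤ 3 / 4 then t + 1 / 8 else (t + 1) / 2

/-- The homeomorphism `x₀` of `[0,1]`. -/
noncomputable def x0 : I ≃o I where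
  toFun t := ⟨x0Fun t, by
    obtain ⟨t, h0, h1⟩ := t
    simp only [x0Fun, mem_Icc]
    split_ifs <;> constructor <;> linarith⟩
  invFun t := ⟨x0Inv t, by
    obtain ⟨t, h0, h1⟩ := t
    simp only [x0Inv, mem_Icc]
    split_ifs <;> constructor <;> linarith⟩
  left_inv t := by
    apply Subtype.ext
    simp only [x0Fun, x0Inv]
    split_ifs <;> linarith
  right_inv t := by
    apply Subtype.ext
    simp only [x0Fun, x0Inv]
    split_ifs <;> linarith
  map_rel_iff' := by
    intro s t
    simp only [Equiv.coe_fn_mk, ← Subtype.coe_le_coe, x0Fun]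
    split_ifs <;> constructor <;> intro h <;> linarith

/-- The homeomorphism `x₁` of `[0,1]`. -/
noncomputable def x1 : I ≃o I where
  toFun t := ⟨x1Fun t, by
    obtain ⟨t, h0, h1⟩ := t
    simp only [x1Fun, mem_Icc]
    split_ifs <;> constructor <;> linarith⟩
  invFun t := ⟨x1Inv t, by
    obtain ⟨t, h0, h1⟩ := t
    simp only [x1Inv, mem_Icc]
    split_ifs <;> constructor <;> linarith⟩
  left_inv t := by
    apply Subtype.ext
    simp only [x1Fun, x1Inv]
    split_ifs <;> linarith
  right_inv t := by
    apply Subtype.ext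
    simp only [x1Fun, x1Inv]
    split_ifs <;> linarith
  map_rel_iff' := by
    intro s t
    simp only [Equiv.coe_fn_mk, ← Subtype.coe_le_coe, x1Fun]
    split_ifs <;> constructor <;> intro h <;> linarith

theorem eventually_lt_coe {t : I} {a : ℝ} (h : (t : ℝ) < a) : ∀ᶠ s : I in 𝓝 t, (s : ℝ) < a :=
  continuous_subtype_val.continuousAt.eventually (Iio_mem_nhds h)

theorem eventually_gt_coe {t : I} {a : ℝ} (h : a < (t : ℝ)) : ∀ᶠ s : I in 𝓝 t, a < (s : ℝ) :=
  continuous_subtype_val.continuousAt.eventually (Ioi_mem_nhds h)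

theorem x0_isDyadicPL : IsDyadicPL x0 := by
  classical
  refine ⟨{⟨1 / 2, by norm_num, by norm_num⟩, ⟨3 / 4, by norm_num, by norm_num⟩}, ?_, ?_⟩
  · intro d hd
    simp only [Finset.mem_insert, Finset.mem_singleton] at hd
    rcases hd with rfl | rfl
    · exact ⟨1, 1, by norm_num⟩
    · exact ⟨3, 2, by norm_num⟩
  · intro t ht
    simp only [Finset.mem_insert, Finset.mem_singleton, Subtype.ext_iff, not_or] at ht
    have hx : ∀ s : I, (x0 s : ℝ) = x0Fun s := fun _ => rfl
    rcases lt_or_gt_of_ne ht.1 with h | h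
    · refine ⟨-1, 0, ?_⟩
      filter_upwards [eventually_lt_coe h] with s hs
      rw [hx, x0Fun, if_pos hs.le]
      norm_num; ring
    rcases lt_or_gt_of_ne ht.2 with h' | h'
    · refine ⟨0, -1 / 4, ?_⟩
      filter_upwards [eventually_gt_coe h, eventually_lt_coe h'] with s hs hs'
      rw [hx, x0Fun, if_neg hs.not_ge, if_pos hs'.le]
      norm_num; ring
    · refine ⟨1, -1, ?_⟩
      filter_upwards [eventually_gt_coe h, eventually_gt_coe h'] with s hs hs'
      rw [hx, x0Fun, if_neg hs.not_ge, if_neg hs'.not_ge]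
      norm_num; ring

theorem x1_isDyadicPL : IsDyadicPL x1 := by
  classical
  refine ⟨{⟨1 / 2, by norm_num, by norm_num⟩, ⟨3 / 4, by norm_num, by norm_num⟩,
    ⟨7 / 8, by norm_num, by norm_num⟩}, ?_, ?_⟩
  · intro d hd
    simp only [Finset.mem_insert, Finset.mem_singleton] at hd
    rcases hd with rfl | rfl | rfl
    · exact ⟨1, 1, by norm_num⟩
    · exact ⟨3, 2, by norm_num⟩
    · exact ⟨7, 3, by norm_num⟩
  · intro t ht
    simp only [Finset.mem_insert, Finset.mem_singleton, Subtype.ext_iff, not_or] at ht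
    have hx : ∀ s : I, (x1 s : ℝ) = x1Fun s := fun _ => rfl
    rcases lt_or_gt_of_ne ht.1 with h | h
    · refine ⟨0, 0, ?_⟩
      filter_upwards [eventually_lt_coe h] with s hs
      rw [hx, x1Fun, if_pos hs.le]
      norm_num
    rcases lt_or_gt_of_ne ht.2.1 with h' | h'
    · refine ⟨-1, 1 / 4, ?_⟩
      filter_upwards [eventually_gt_coe h, eventually_lt_coe h'] with s hs hs'
      rw [hx, x1Fun, if_neg hs.not_ge, if_pos hs'.le]
      norm_num; ring
    rcases lt_or_gt_of_ne ht.2.2 with h'' | h''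
    · refine ⟨0, -1 / 8, ?_⟩
      filter_upwards [eventually_gt_coe h, eventually_gt_coe h', eventually_lt_coe h'']
        with s hs hs' hs''
      rw [hx, x1Fun, if_neg hs.not_ge, if_neg hs'.not_ge, if_pos hs''.le]
      norm_num; ring
    · refine ⟨1, -1, ?_⟩
      filter_upwards [eventually_gt_coe h, eventually_gt_coe h', eventually_gt_coe h'']
        with s hs hs' hs''
      rw [hx, x1Fun, if_neg hs.not_ge, if_neg hs'.not_ge, if_neg hs''.not_ge]
      norm_num; ring

/-- The generating pair `x₀, x₁` of `F`, indexed by the labels `0, 1`. -/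
noncomputable def gen : Fin 2 → thompsonF :=
  ![⟨x0, x0_isDyadicPL⟩, ⟨x1, x1_isDyadicPL⟩]

/-- The dyadic rational numbers of the open interval `(0,1)`, as points of `[0,1]`. -/
def DyadicPoint : Type := {q : I // IsDyadic q ∧ 0 < (q : ℝ) ∧ (q : ℝ) < 1}

/-- The point `1/2`. -/
noncomputable def DyadicPoint.half : DyadicPoint :=
  ⟨⟨1 / 2, by norm_num, by norm_num⟩, ⟨1, 1, by norm_num⟩, by norm_num, by norm_num⟩


theorem gen_zero_smul (t : I) : ((gen 0 • t : I) : ℝ) = x0Fun t := rfl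

theorem gen_one_smul (t : I) : ((gen 1 • t : I) : ℝ) = x1Fun t := rfl

theorem gen_zero_inv_smul (t : I) : (((gen 0)⁻¹ • t : I) : ℝ) = x0Inv t := rfl

theorem gen_one_inv_smul (t : I) : (((gen 1)⁻¹ • t : I) : ℝ) = x1Inv t := rfl

theorem exists_smul_eq_half (n : ℕ) : ∀ (t : I) (a : ℤ), (t : ℝ) * 2 ^ n = a → 0 < (t : ℝ) →
    (t : ℝ) < 1 → ∃ g ∈ Subgroup.closure (Set.range gen), ((g • t : I) : ℝ) = 1 / 2 := by
  have mem (i : Fin 2) : gen i ∈ Subgroup.closure (Set.range gen) :=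
    Subgroup.subset_closure ⟨i, rfl⟩
  -- it suffices to solve the problem for some image of `t`
  have step : ∀ (t : I) (h : thompsonF), h ∈ Subgroup.closure (Set.range gen) →
      (∃ g ∈ Subgroup.closure (Set.range gen), ((g • (h • t) : I) : ℝ) = 1 / 2) →
      ∃ g ∈ Subgroup.closure (Set.range gen), ((g • t : I) : ℝ) = 1 / 2 := by
    rintro t h hh ⟨g, hg, h'⟩
    exact ⟨g * h, mul_mem hg hh, by rw [mul_smul, h']⟩
  induction n with
  | zero =>
    intro t a h h0 h1
    simp only [pow_zero, mul_one] at h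
    rw [h] at h0 h1
    norm_cast at h0 h1
    omega
  | succ n ih =>
    -- the case `1/2 < t < 3/4`
    have mid : ∀ (t : I) (a : ℤ), (t : ℝ) * 2 ^ (n + 1) = a → 1 / 2 < (t : ℝ) →
        (t : ℝ) < 3 / 4 → ∃ g ∈ Subgroup.closure (Set.range gen),
          ((g • t : I) : ℝ) = 1 / 2 := by
      intro t a h h0 h1
      obtain _ | n := n
      · norm_num at h
        have h2 : (1 : ℝ) < a := by linarith
        have h3 : (a : ℝ) < 2 := by linarith
        norm_cast at h2 h3
        omega
      rcases le_or_gt (t : ℝ) (5 / 8) with h5 | h5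
      · apply step t _ (inv_mem (mem 1))
        have e : (((gen 1)⁻¹ • t : I) : ℝ) = 2 * t - 1 / 2 := by
          rw [gen_one_inv_smul, x1Inv, if_neg (by linarith), if_pos h5]
        refine ih _ (a - 2 ^ n) ?_ (by rw [e]; linarith) (by rw [e]; linarith)
        rw [e]; push_cast; rw [← h]; ring
      · obtain _ | n := n
        · norm_num at h
          have h2 : (2 : ℝ) < a := by linarith
          have h3 : (a : ℝ) < 3 := by linarith
          norm_cast at h2 h3
          omega
        apply step t _ (inv_mem (mem 1))
        apply step _ _ (mem 0)
        have e : (((gen 1)⁻¹ • t : I) : ℝ) = t + 1 / 8 := by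
          rw [gen_one_inv_smul, x1Inv, if_neg (by linarith), if_neg (by linarith),
            if_pos h1.le]
        have e' : ((gen 0 • ((gen 1)⁻¹ • t) : I) : ℝ) = 2 * t - 3 / 4 := by
          rw [gen_zero_smul, e, x0Fun, if_neg (by linarith), if_neg (by linarith)]
          ring
        refine ih _ (a - 3 * 2 ^ n) ?_ (by rw [e']; linarith) (by rw [e']; linarith)
        rw [e']; push_cast; rw [← h]; ring
    intro t a h h0 h1
    rcases le_or_gt (t : ℝ) (1 / 4) with h4 | h4
    · apply step t _ (inv_mem (mem 0))
      have e : (((gen 0)⁻¹ • t : I) : ℝ) = 2 * t := by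
        rw [gen_zero_inv_smul, x0Inv, if_pos h4]
      refine ih _ a ?_ (by rw [e]; linarith) (by rw [e]; linarith)
      rw [e, ← h]; ring
    rcases lt_trichotomy (t : ℝ) (1 / 2) with h2 | h2 | h2
    · obtain _ | n := n
      · norm_num at h
        have h2 : (0 : ℝ) < a := by linarith
        have h3 : (a : ℝ) < 1 := by linarith
        norm_cast at h2 h3
        omega
      apply step t _ (inv_mem (mem 0))
      have e : (((gen 0)⁻¹ • t : I) : ℝ) = t + 1 / 4 := by
        rw [gen_zero_inv_smul, x0Inv, if_neg (by linarith), if_pos h2.le]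
      refine mid _ (a + 2 ^ n) ?_ (by rw [e]; linarith) (by rw [e]; linarith)
      rw [e]; push_cast; rw [← h]; ring
    · exact ⟨1, one_mem _, by rw [one_smul, h2]⟩
    rcases lt_or_ge (t : ℝ) (3 / 4) with h3 | h3
    · exact mid t a h h2 h3
    · apply step t _ (mem 0)
      have e : ((gen 0 • t : I) : ℝ) = 2 * t - 1 := by
        rw [gen_zero_smul, x0Fun, if_neg (by linarith)]
        split_ifs <;> linarith
      refine ih _ (a - 2 ^ n) ?_ (by rw [e]; linarith) (by rw [e]; linarith)
      rw [e]; push_cast; rw [← h]; ring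

theorem DyadicPoint.exists_smul_eq (q r : DyadicPoint) :
    ∃ g ∈ Subgroup.closure (Set.range gen), g • q.1 = r.1 := by
  obtain ⟨⟨a, n, ha⟩, hq0, hq1⟩ := q.2
  obtain ⟨⟨b, m, hb⟩, hr0, hr1⟩ := r.2
  obtain ⟨g, hg, hgq⟩ := exists_smul_eq_half n q.1 a (by rw [ha]; field_simp) hq0 hq1
  obtain ⟨h, hh, hhr⟩ := exists_smul_eq_half m r.1 b (by rw [hb]; field_simp) hr0 hr1
  refine ⟨h⁻¹ * g, mul_mem (inv_mem hh) hg, ?_⟩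
  rw [mul_smul, inv_smul_eq_iff]
  exact Subtype.ext (hgq.trans hhr.symm)

theorem smul_zero_eq (f : thompsonF) : f • (0 : I) = 0 := f.1.map_bot

theorem smul_one_eq (f : thompsonF) : f • (1 : I) = 1 := f.1.map_top

/-- `F` maps dyadic rationals in `(0,1)` to dyadic rationals in `(0,1)`. -/
def DyadicPoint.map (f : thompsonF) (q : DyadicPoint) : DyadicPoint :=
  ⟨f • q.1, (IsDyadicPL.isDyadic_iff f.2 q.1).2 q.2.1, by
    have h : f.1 0 < f.1 q.1 := f.1.strictMono q.2.2.1
    rwa [show f.1 0 = 0 from smul_zero_eq f] at h, by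
    have h : f.1 q.1 < f.1 1 := f.1.strictMono q.2.2.2
    rwa [show f.1 1 = 1 from smul_one_eq f] at h⟩

/-! ### Marked pointed graphs -/

/-- A connected regular marked pointed graph: an oriented graph with a base vertex whose edges
are labeled by `0` (for `x₀`) and `1` (for `x₁`), such that every vertex is the initial vertex of
exactly one edge and the terminal vertex of exactly one edge of each label.
`E s x y` means that there is an edge labeled by `s` from `x` to `y`. -/
structure PGraph where
  /-- vertices -/
  V : Type
  /-- labeled oriented edges -/
  E : Fin 2 → V → V → Prop
  /-- the selected vertex -/
  base : V
  out_unique : ∀ s x, ∃! y, E s x y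
  in_unique : ∀ s y, ∃! x, E s x y
  connected : ∀ v, Relation.EqvGen (fun x y => ∃ s, E s x y) base v

namespace PGraph

/-- Isomorphism of marked pointed graphs. -/
def Iso (Γ Δ : PGraph) : Prop :=
  ∃ e : Γ.V ≃ Δ.V, e Γ.base = Δ.base ∧ ∀ s x y, Γ.E s x y ↔ Δ.E s (e x) (e y)

/-- The same graph with another base vertex `v`. -/
def rebase (Γ : PGraph) (v : Γ.V) : PGraph :=
  { Γ with base := v, connected := fun u => ((Γ.connected v).symm _ _).trans _ _ _ (Γ.connected u) }

/-- The vertices of the ball of radius `n` around the base vertex, for the path metric of the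
underlying non-oriented graph. -/
def ball (Γ : PGraph) : ℕ → Set Γ.V
  | 0 => {Γ.base}
  | n + 1 => Γ.ball n ∪ {y | ∃ x ∈ Γ.ball n, ∃ s, Γ.E s x y ∨ Γ.E s y x}

/-- The balls of radius `n` around the base vertices (as induced subgraphs) are isomorphic as
marked pointed graphs. -/
def BallIso (n : ℕ) (Γ Δ : PGraph) : Prop :=
  ∃ f : Γ.V → Δ.V, BijOn f (Γ.ball n) (Δ.ball n) ∧ f Γ.base = Δ.base ∧
    ∀ s, ∀ x ∈ Γ.ball n, ∀ y ∈ Γ.ball n, Γ.E s x y ↔ Δ.E s (f x) (f y)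

theorem ball_mono (Γ : PGraph) : Monotone Γ.ball :=
  monotone_nat_of_le_succ fun _ => subset_union_left

theorem base_mem_ball (Γ : PGraph) (n : ℕ) : Γ.base ∈ Γ.ball n :=
  Γ.ball_mono (Nat.zero_le n) rfl

theorem BallIso.refl (n : ℕ) (Γ : PGraph) : BallIso n Γ Γ :=
  ⟨id, bijOn_id _, rfl, fun _ _ _ _ _ => Iff.rfl⟩

theorem BallIso.symm {n : ℕ} {Γ Δ : PGraph} (h : BallIso n Γ Δ) : BallIso n Δ Γ := by
  obtain ⟨f, hf, hb, hE⟩ := h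
  have : Nonempty Γ.V := ⟨Γ.base⟩
  have hinv := hf.invOn_invFunOn
  have hbij : BijOn (Function.invFunOn f (Γ.ball n)) (Δ.ball n) (Γ.ball n) :=
    hf.symm hinv.symm
  refine ⟨Function.invFunOn f (Γ.ball n), hbij, ?_, fun s x hx y hy => ?_⟩
  · rw [← hb]
    exact hinv.1 (Γ.base_mem_ball n)
  · rw [hE s _ (hbij.mapsTo hx) _ (hbij.mapsTo hy), hinv.2 hx, hinv.2 hy]

theorem BallIso.trans {n : ℕ} {Γ Δ Θ : PGraph} (h : BallIso n Γ Δ) (h' : BallIso n Δ Θ) :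
    BallIso n Γ Θ := by
  obtain ⟨f, hf, hb, hE⟩ := h
  obtain ⟨g, hg, hb', hE'⟩ := h'
  refine ⟨g ∘ f, hg.comp hf, by simp [hb, hb'], fun s x hx y hy => ?_⟩
  rw [hE s x hx y hy, hE' s _ (hf.mapsTo hx) _ (hf.mapsTo hy)]
  rfl

theorem BallIso.mono {m n : ℕ} (hmn : m ≤ n) {Γ Δ : PGraph} (h : BallIso n Γ Δ) :
    BallIso m Γ Δ := by
  obtain ⟨f, hf, hb, hE⟩ := h
  have key : ∀ k ≤ n, MapsTo f (Γ.ball k) (Δ.ball k) ∧ SurjOn f (Γ.ball k) (Δ.ball k) := by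
    intro k
    induction k with
    | zero =>
      intro _
      refine ⟨fun x hx => ?_, fun y hy => ⟨Γ.base, rfl, ?_⟩⟩
      · rw [mem_singleton_iff.1 hx]; exact hb
      · rw [mem_singleton_iff.1 hy]; exact hb
    | succ k ih =>
      intro hk
      obtain ⟨ihm, ihs⟩ := ih (by omega)
      have hsub := Γ.ball_mono (show k ≤ n by omega)
      refine ⟨fun x hx => ?_, fun y hy => ?_⟩
      · have hxn := Γ.ball_mono hk hx
        rcases hx with hx | ⟨z, hz, s, hs⟩
        · exact Or.inl (ihm hx)
        · refine Or.inr ⟨f z, ihm hz, s, ?_⟩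
          rwa [← hE s z (hsub hz) x hxn, ← hE s x hxn z (hsub hz)]
      · obtain ⟨x, hx, rfl⟩ := hf.surjOn (Δ.ball_mono hk hy)
        rcases hy with hy | ⟨z, hz, s, hs⟩
        · obtain ⟨x', hx', h⟩ := ihs hy
          exact ⟨x', Or.inl hx', h⟩
        · obtain ⟨z', hz', rfl⟩ := ihs hz
          refine ⟨x, Or.inr ⟨z', hz', s, ?_⟩, rfl⟩
          rwa [hE s z' (hsub hz') x hx, hE s x hx z' (hsub hz')]
  exact ⟨f, ⟨(key m hmn).1, hf.injOn.mono (Γ.ball_mono hmn), (key m hmn).2⟩, hb,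
    fun s x hx y hy => hE s x (Γ.ball_mono hmn hx) y (Γ.ball_mono hmn hy)⟩

open Classical in
/-- The distance `2 ^ (-n)`, where `n` is the largest integer such that the balls of radius `n`
around the base vertices are isomorphic (`n = -1` if not even the balls of radius `0` are, and
`n = ∞` if all of them are). Since isomorphic balls of radius `n` contain isomorphic balls of all
smaller radii, this `n` is the predecessor of the smallest radius with non-isomorphic balls. -/
noncomputable def graphDist (Γ Δ : PGraph) : ℝ :=
  if h : ∃ n, ¬ BallIso n Γ Δ then 2 ^ (-((Nat.find h : ℤ) - 1)) else 0

theorem graphDist_le_iff (Γ Δ : PGraph) (n : ℕ) :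
    graphDist Γ Δ ≤ 2 ^ (-(n : ℤ)) ↔ BallIso n Γ Δ := by
  classical
  unfold graphDist
  split_ifs with h
  · rw [zpow_le_zpow_iff_right₀ (by norm_num : (1 : ℝ) < 2)]
    constructor
    · intro h'
      have : n < Nat.find h := by omega
      exact not_not.1 (Nat.find_min h this)
    · intro h'
      by_contra hlt
      exact Nat.find_spec h (h'.mono (by omega))
  · push Not at h
    exact iff_of_true (by positivity) (h n)

theorem graphDist_nonneg (Γ Δ : PGraph) : 0 ≤ graphDist Γ Δ := by
  unfold graphDist
  split_ifs <;> positivity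

theorem graphDist_self (Γ : PGraph) : graphDist Γ Γ = 0 := by
  unfold graphDist
  rw [dif_neg]
  push Not
  exact fun n => BallIso.refl n Γ

theorem graphDist_comm (Γ Δ : PGraph) : graphDist Γ Δ = graphDist Δ Γ := by
  have : ∀ n, BallIso n Γ Δ ↔ BallIso n Δ Γ := fun n => ⟨.symm, .symm⟩
  classical
  unfold graphDist
  split_ifs with h h' h'
  · rw [Nat.find_congr' (@fun n => not_congr (this n))]
  · exact absurd (h.imp fun n => (not_congr (this n)).1) h'
  · exact absurd (h'.imp fun n => (not_congr (this n)).2) h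
  · rfl

theorem graphDist_triangle (Γ Δ Θ : PGraph) :
    graphDist Γ Θ ≤ graphDist Γ Δ + graphDist Δ Θ := by
  classical
  by_cases h : ∃ n, ¬ BallIso n Γ Θ
  · have hor : ¬ BallIso (Nat.find h) Γ Δ ∨ ¬ BallIso (Nat.find h) Δ Θ := by
      by_contra hc
      push Not at hc
      exact Nat.find_spec h (hc.1.trans hc.2)
    have hle : ∀ Γ' Δ' : PGraph, ¬ BallIso (Nat.find h) Γ' Δ' →
        graphDist Γ Θ ≤ graphDist Γ' Δ' := by
      intro Γ' Δ' hn
      have h' : ∃ n, ¬ BallIso n Γ' Δ' := ⟨_, hn⟩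
      have hf : Nat.find h' ≤ Nat.find h := Nat.find_min' h' hn
      unfold graphDist
      rw [dif_pos h, dif_pos h', zpow_le_zpow_iff_right₀ (by norm_num : (1 : ℝ) < 2)]
      omega
    rcases hor with h1 | h1
    · linarith [hle _ _ h1, graphDist_nonneg Δ Θ]
    · linarith [hle _ _ h1, graphDist_nonneg Γ Δ]
  · have : graphDist Γ Θ = 0 := by
      unfold graphDist
      rw [dif_neg h]
    rw [this]
    exact add_nonneg (graphDist_nonneg _ _) (graphDist_nonneg _ _)

/-- The topology of pointed marked graphs. On isomorphism classes `graphDist` is a metric. -/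
noncomputable instance : PseudoMetricSpace PGraph where
  dist := graphDist
  dist_self := graphDist_self
  dist_comm := graphDist_comm
  dist_triangle := graphDist_triangle

end PGraph

/-! ### Schreier graphs of dyadic rationals -/

/-- The pointed Schreier graph `Γ_q` of the action of `F`, with generators `x₀, x₁`, on the orbit
of `q`: there is an edge labeled by `s` from `x` to `y` iff the generator `s` maps `x` to `y`. -/
def schreierGraph (q : DyadicPoint) : PGraph where
  V := MulAction.orbit thompsonF q.1
  E s x y := gen s • x = y
  base := ⟨q.1, MulAction.mem_orbit_self _⟩
  out_unique s x := ⟨gen s • x, rfl, fun _ h => h.symm⟩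
  in_unique s y := ⟨(gen s)⁻¹ • y, smul_inv_smul _ _, fun x h => by
    change gen s • x = y at h
    rw [← h, inv_smul_smul]⟩
  connected := by
    have key : ∀ g ∈ Subgroup.closure (Set.range gen), ∀ p : MulAction.orbit thompsonF q.1,
        Relation.EqvGen (fun x y : MulAction.orbit thompsonF q.1 => ∃ s, gen s • x = y)
          p (g • p) := by
      intro g hg
      induction hg using Subgroup.closure_induction with
      | mem x hx =>
        obtain ⟨s, rfl⟩ := hx
        exact fun p => .rel _ _ ⟨s, rfl⟩
      | one => intro p; rw [one_smul]; exact .refl _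
      | mul x y _ _ hx hy => intro p; rw [mul_smul]; exact .trans _ _ _ (hy p) (hx _)
      | inv x _ hx =>
        intro p
        have := hx (x⁻¹ • p)
        rw [smul_inv_smul] at this
        exact .symm _ _ this
    rintro ⟨v, f, rfl⟩
    obtain ⟨g, hg, h⟩ := q.exists_smul_eq (q.map f)
    have := key g hg ⟨q.1, MulAction.mem_orbit_self _⟩
    convert this using 1
    exact Subtype.ext h.symm

/-- The family of the pointed Schreier graphs of all dyadic rationals in `(0,1)`. -/
def dyadicFamily : Set PGraph := Set.range schreierGraph

/-! ### The limit graphs -/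

/-- The grey vertices of the graph with an infinite path going up from the grey vertex `s₀`,
through the grey vertices `s₁, s₂, …`:
* `below v` is reached from `s₀` by descending along the finite word `v`; `below []` is `s₀`;
* `above k` is `s_{k+1}`;
* `side k v` is reached by descending along the finite word `v` from the child of `s_{k+1}` that
  is not `s_k`.

Words of descending paths are written from bottom to top. The letter `0` is `false` and the letter
`1` is `true`. -/
inductive Grey : Type
  | below (v : List Bool)
  | above (k : ℕ)
  | side (k : ℕ) (v : List Bool)

/-- The grey vertex `s_k` of the infinite path. -/
def Grey.spine : ℕ → Grey
  | 0 => below []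
  | k + 1 => above k

/-- The left (`a = 0`) or right (`a = 1`) turn at the `k`-th level of the upward path is prescribed
by the `k`-th letter of `w`: `s_k` is the `w k`-child of `s_{k+1}`, and below all the other
children hang full binary trees. The child of a grey vertex with label `10u` given by the letter
`a` is the grey vertex with label `10au`. -/
def Grey.child (w : ℕ → Bool) (a : Bool) : Grey → Grey
  | below v => below (a :: v)
  | above k => if a = w k then spine k else side k []
  | side k v => side k (a :: v)

/-- Each grey vertex `g` with label `10u` lies on a line of vertices `(g, j)`, `j : ℤ`: for `j = 0`
this is the grey vertex `10u` itself, for `j ≥ 1` it is the black vertex with label `0^j 1u`, and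
for `j ≤ -1` it is the white vertex with label `1^(1-j) 0u`. This is the end of the edge labeled
by `s` that starts at a given vertex: `x₀` moves along the line; `x₁` fixes the black vertices,
leads from the grey vertex to its `0`-child, from the first white vertex to the `1`-child of the
grey vertex, and moves along the line at the other white vertices. -/
def limitStep (w : ℕ → Bool) : Fin 2 → Grey × ℤ → Grey × ℤ
  | 0, (g, j) => (g, j + 1)
  | 1, (g, j) =>
    if 1 ≤ j then (g, j)
    else if j = 0 then (g.child w false, 0)
    else if j = -1 then (g.child w true, 0)
    else (g, j + 1)

theorem Grey.child_ne (w : ℕ → Bool) (g h : Grey) : g.child w false ≠ h.child w true := by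
  rcases g with v | _ | k | ⟨k, v⟩ <;> rcases h with v' | _ | k' | ⟨k', v'⟩ <;>
    simp only [child, spine] <;> grind

theorem Grey.child_injective (w : ℕ → Bool) (a : Bool) :
    Function.Injective (Grey.child w a) := by
  intro g h
  rcases g with v | _ | k | ⟨k, v⟩ <;> rcases h with v' | _ | k' | ⟨k', v'⟩ <;>
    simp only [child, spine] <;> grind

theorem Grey.exists_child_eq (w : ℕ → Bool) (g : Grey) : ∃ a h, Grey.child w a h = g := by
  rcases g with (_ | ⟨a, v⟩) | k | ⟨k, (_ | ⟨a, v⟩)⟩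
  · exact ⟨w 0, above 0, by simp [child, spine]⟩
  · exact ⟨a, below v, rfl⟩
  · exact ⟨w (k + 1), above (k + 1), by simp [child, spine]⟩
  · exact ⟨!w k, above k, by simp [child]⟩
  · exact ⟨a, side k v, rfl⟩

theorem limitStep_injective (w : ℕ → Bool) (s : Fin 2) : Function.Injective (limitStep w s) := by
  rintro ⟨g, i⟩ ⟨h, j⟩ he
  have h1 := @Grey.child_injective w
  have h2 := Grey.child_ne w
  fin_cases s
  · simpa [limitStep] using he
  · simp only [limitStep] at he
    have h3 := @h1 false g h
    have h4 := @h1 true g h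
    have h5 := h2 g h
    have h6 := h2 h g
    split_ifs at he <;> simp only [Prod.mk.injEq] at he ⊢ <;> grind

theorem limitStep_surjective (w : ℕ → Bool) (s : Fin 2) :
    Function.Surjective (limitStep w s) := by
  rintro ⟨g, j⟩
  fin_cases s
  · exact ⟨(g, j - 1), by simp [limitStep]⟩
  · rcases lt_trichotomy j 0 with h | rfl | h
    · refine ⟨(g, j - 1), ?_⟩
      simp only [limitStep]
      rw [if_neg (by omega), if_neg (by omega), if_neg (by omega)]
      simp
    · obtain ⟨a, h, rfl⟩ := g.exists_child_eq w
      cases a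
      · exact ⟨(h, 0), by simp [limitStep]⟩
      · exact ⟨(h, -1), by simp [limitStep]⟩
    · exact ⟨(g, j), by simp only [limitStep]; rw [if_pos (by omega)]⟩

theorem limitGraph_connected (w : ℕ → Bool) (p v : Grey × ℤ) :
    Relation.EqvGen (fun x y => ∃ s, limitStep w s x = y) p v := by
  have line (g : Grey) (j : ℤ) :
      Relation.EqvGen (fun x y => ∃ s, limitStep w s x = y) (g, 0) (g, j) := by
    induction j using Int.induction_on with
    | zero => exact .refl _
    | succ i ih => exact ih.trans _ _ _ (.rel _ _ ⟨0, rfl⟩)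
    | pred i ih =>
      refine ih.trans _ _ _ (.symm _ _ (.rel _ _ ⟨0, ?_⟩))
      simp [limitStep]
  have child (a : Bool) (g : Grey) :
      Relation.EqvGen (fun x y => ∃ s, limitStep w s x = y) (g, 0) (g.child w a, 0) := by
    cases a
    · exact .rel _ _ ⟨1, by simp [limitStep]⟩
    · exact (line g (-1)).trans _ _ _ (.rel _ _ ⟨1, by simp [limitStep]⟩)
  have below (v : List Bool) : Relation.EqvGen (fun x y => ∃ s, limitStep w s x = y)
      (Grey.below [], 0) (Grey.below v, 0) := by
    induction v with
    | nil => exact .refl _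
    | cons a v ih => exact ih.trans _ _ _ (child a (.below v))
  have spine (k : ℕ) : Relation.EqvGen (fun x y => ∃ s, limitStep w s x = y)
      (Grey.below [], 0) (Grey.spine k, 0) := by
    induction k with
    | zero => exact .refl _
    | succ k ih =>
      refine ih.trans _ _ _ (.symm _ _ ?_)
      have := child (w k) (.above k)
      rwa [Grey.child, if_pos rfl] at this
  have side (k : ℕ) (v : List Bool) : Relation.EqvGen (fun x y => ∃ s, limitStep w s x = y)
      (Grey.below [], 0) (Grey.side k v, 0) := by
    induction v with
    | nil =>
      refine (spine (k + 1)).trans _ _ _ ?_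
      have := child (!w k) (.above k)
      rwa [Grey.child, if_neg (by simp)] at this
    | cons a v ih => exact ih.trans _ _ _ (child a (.side k v))
  have all (p : Grey × ℤ) : Relation.EqvGen (fun x y => ∃ s, limitStep w s x = y)
      (Grey.below [], 0) p := by
    obtain ⟨v | k | ⟨k, v⟩, j⟩ := p
    · exact (below v).trans _ _ _ (line _ _)
    · exact (spine (k + 1)).trans _ _ _ (line _ _)
    · exact (side k v).trans _ _ _ (line _ _)
  exact (Relation.EqvGen.symm _ _ (all p)).trans _ _ _ (all v)

/-- The graph with an infinite path going up from a grey vertex labeled by `10w`, which turns left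
or right at the `k`-th level if the `k`-th letter of `w` is `0` or `1`. The base vertex is the
vertex at position `j` of the line of that grey vertex. -/
def upwardGraph (w : ℕ → Bool) (j : ℤ) : PGraph where
  V := Grey × ℤ
  E s x y := limitStep w s x = y
  base := (Grey.spine 0, j)
  out_unique s x := ⟨limitStep w s x, rfl, fun _ h => h.symm⟩
  in_unique s y := Function.Bijective.existsUnique
    ⟨limitStep_injective w s, limitStep_surjective w s⟩ y
  connected := limitGraph_connected w _

/-- The two graphs that are quasi-isometric to a line: there is an edge labeled by `x₀` from each
integer `j` to `j + 1`; the edge labeled by `x₁` that starts at `j` is a loop in the first graph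
(`b = 0`) and goes to `j + 1` as well in the second one (`b = 1`). -/
def lineGraph (b : Bool) : PGraph where
  V := ℤ
  E s x y := y = if s = 1 ∧ b = false then x else x + 1
  base := 0
  out_unique _ _ := ⟨_, rfl, fun _ h => h⟩
  in_unique s y := by
    by_cases h : s = 1 ∧ b = false
    · exact ⟨y, by simp [h], fun x hx => by simpa [h] using hx.symm⟩
    · refine ⟨y - 1, by simp [h], fun x hx => ?_⟩
      simp only [h, if_false] at hx
      omega
  connected v := by
    induction v using Int.induction_on with
    | zero => exact .refl _
    | succ i ih => exact ih.trans _ _ _ (.rel _ _ ⟨0, by simp⟩)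
    | pred i ih => exact ih.trans _ _ _ (.symm _ _ (.rel _ _ ⟨0, by simp⟩))

/-- The infinite word `a^n b w`, where `b` is the letter different from `a`. -/
def blockWord (a : Bool) (n : ℕ) (w : ℕ → Bool) : ℕ → Bool := fun i =>
  if i < n then a else if i = n then !a else w (i - n - 1)

open Classical in
/-- The limit graph `Γ̃_ξ` whose base vertex has the label `ξ`. If `ξ = 1^n 0 w` with `n ≥ 1`, the
base vertex is the grey vertex `10w` or a white vertex of its line; if `ξ = 0^n 1 w` with `n ≥ 1`,
it is a black vertex of the line of the grey vertex `10w`; if `ξ` is constant, the graph is a line.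
Here `n` is the number of letters in the first block of `ξ`. -/
noncomputable def limitGraph (ξ : ℕ → Bool) : PGraph :=
  if h : ∃ n, ξ n ≠ ξ 0 then
    upwardGraph (fun i => ξ (Nat.find h + 1 + i))
      (if ξ 0 = true then 1 - (Nat.find h : ℤ) else (Nat.find h : ℤ))
  else lineGraph (ξ 0)

/-- The two cases of the definition of `limitGraph` for non-constant labels. -/
theorem limitGraph_blockWord (a : Bool) (n : ℕ) (hn : 1 ≤ n) (w : ℕ → Bool) :
    limitGraph (blockWord a n w) = upwardGraph w (if a = true then 1 - (n : ℤ) else n) := by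
  classical
  have h0 : blockWord a n w 0 = a := if_pos (by omega)
  have hne : ∃ m, blockWord a n w m ≠ blockWord a n w 0 := ⟨n, by rw [h0]; simp [blockWord]⟩
  have hfind : Nat.find hne = n := by
    rw [Nat.find_eq_iff]
    refine ⟨by rw [h0]; simp [blockWord], fun m hm => ?_⟩
    rw [h0]
    simp [blockWord, hm]
  unfold limitGraph
  rw [dif_pos hne, hfind, h0]
  congr 1
  funext i
  simp only [blockWord]
  rw [if_neg (by omega), if_neg (by omega)]
  congr 1
  omega

theorem limitGraph_const (a : Bool) : limitGraph (fun _ => a) = lineGraph a := by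
  simp [limitGraph]

end ThompsonSchreier

namespace ThompsonSchreier

open Set Filter Topology

/-! A pointed graph in which every label acts as a permutation is determined by the words of its
closed walks at the base vertex (`iso_of_isLoop_iff`), and Γ lies in the closure of a family iff for
each N some member has the same closed walks of length at most N (`mem_closure_iff_isLoop`).
Everything is therefore about words that fix a point.

Coordinates make the action of F combinatorial. A dyadic point of (0,1) is a pair (u, j), where u is
a word with finitely many letters 1 and the binary expansion is 0^j 1 u for j ≥ 1 and 1^(1-j) 0 u
for j ≤ 0. In these coordinates the generators are the steps `lineStep wordTree`
(`wordPoint_lineStep`): they move along the line of u, or between u and its children 0u and 1u. The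
graph with upward path w has the same steps on words that also carry a level (`lineStep levelTree`,
`upwardGraph_isLoop_iff`). Levels are needed because words can repeat along the way up, for example
if w is periodic, whereas the graph contains no such cycles.

Two locality facts link the models. If the last 1 of u is deeper than the length of a walk, closed
walks preserve the level, so forgetting levels changes nothing (`walk_wordTree_eq_iff`). With
levels, whether a walk is closed depends only on a prefix of the word
(`walk_levelTree_eq_iff_of_prefix`). Far out on a line, only a line graph is visible
(`walk_lineStep_of_lt`, `walk_lineStep_of_lt_neg`).

A graph in the closure gives a sequence (u_n, j_n), and an ultrafilter decides its fate. If j_n is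
not almost everywhere constant, it escapes to one end and the limit is a line. Otherwise u_n
converges letterwise to some w. If the nonzero parts have bounded length, u_n is almost everywhere
one finite word and the limit is a Schreier graph; if not, the root recedes and the limit is an
upward graph over w. Truncations of w and points far out on a line give the converse.

The labels can be recovered because the x₁-loops of an upward graph sit exactly at the positions j ≥
1. They reveal the position of any vertex reached by a walk, and the position reached by x₁⁻¹ from a
grey vertex reveals the first letter of its word (`eq_of_forall_walk_levelTree`). -/

/-! ### Walks -/

/-- The end of the walk from `x` that follows the word `l` in `σ 0`, `σ 1` and their inverses; the
letter `(s, true)` stands for `σ s` and `(s, false)` for its inverse. -/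
def walk {α : Type*} (σ : Fin 2 → Equiv.Perm α) : List (Fin 2 × Bool) → α → α
  | [], x => x
  | (s, b) :: l, x => walk σ l (bif b then σ s x else (σ s).symm x)

/-- The word of the reversed walk. -/
def invWord (l : List (Fin 2 × Bool)) : List (Fin 2 × Bool) :=
  (l.map fun c => (c.1, !c.2)).reverse

@[simp] theorem length_invWord (l : List (Fin 2 × Bool)) : (invWord l).length = l.length := by
  simp [invWord]

section Walk

variable {α β : Type*} (σ : Fin 2 → Equiv.Perm α) (τ : Fin 2 → Equiv.Perm β)

@[simp] theorem walk_nil (x : α) : walk σ [] x = x := rfl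

theorem walk_cons (c : Fin 2 × Bool) (l : List (Fin 2 × Bool)) (x : α) :
    walk σ (c :: l) x = walk σ l (walk σ [c] x) := rfl

theorem walk_append (l m : List (Fin 2 × Bool)) (x : α) :
    walk σ (l ++ m) x = walk σ m (walk σ l x) := by
  induction l generalizing x with
  | nil => rfl
  | cons c l ih => exact ih _

theorem walk_invWord_walk (l : List (Fin 2 × Bool)) (x : α) :
    walk σ (invWord l) (walk σ l x) = x := by
  induction l generalizing x with
  | nil => rfl
  | cons c l ih =>
    obtain ⟨s, b⟩ := c
    have : invWord ((s, b) :: l) = invWord l ++ [(s, !b)] := by simp [invWord]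
    rw [this, walk_append, walk_cons σ (s, b) l, ih]
    cases b <;> simp [walk]

/-- Following m backwards is injective and returns the end of m to x. Thus coincidences of vertices
and edges can all be expressed by closed walks. -/
theorem walk_append_invWord_eq_iff (l m : List (Fin 2 × Bool)) (x : α) :
    walk σ (l ++ invWord m) x = x ↔ walk σ l x = walk σ m x := by
  have h : Function.Injective (walk σ (invWord m)) := by
    intro y z hyz
    have key (y : α) : walk σ (invWord (invWord m)) (walk σ (invWord m) y) = y :=
      walk_invWord_walk σ _ y
    rw [← key y, hyz, key]
  rw [walk_append]
  nth_rewrite 2 [← walk_invWord_walk σ m x]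
  exact h.eq_iff

variable {σ τ}

/-- A map that commutes with the generators commutes with walks. -/
theorem map_walk {f : α → β} (hf : ∀ s x, f (σ s x) = τ s (f x)) (l : List (Fin 2 × Bool))
    (x : α) : f (walk σ l x) = walk τ l (f x) := by
  induction l generalizing x with
  | nil => rfl
  | cons c l ih =>
    obtain ⟨s, b⟩ := c
    rw [walk, ih, walk]
    cases b
    · have : τ s (f ((σ s).symm x)) = f x := by rw [← hf, Equiv.apply_symm_apply]
      simp only [cond_false]
      rw [(Equiv.eq_symm_apply (τ s)).2 this]
    · simp only [cond_true, hf]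

/-- A predicate that survives each step, up to increasing its parameter, survives walks. -/
theorem walk_induction {P : ℕ → α → Prop} (hP : ∀ n c x, P n x → P (n + 1) (walk σ [c] x))
    (l : List (Fin 2 × Bool)) {n : ℕ} {x : α} (hx : P n x) :
    P (n + l.length) (walk σ l x) := by
  induction l generalizing n x with
  | nil => exact hx
  | cons c l ih =>
    have := ih (hP n c x hx)
    rwa [walk_cons, List.length_cons, ← add_assoc, add_right_comm]

end Walk

/-! ### Closed walks and the topology of pointed graphs -/

namespace PGraph

variable (Γ Δ : PGraph)

/-- The permutation of the vertices along the edges labeled by `s`. -/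
noncomputable def step (s : Fin 2) : Equiv.Perm Γ.V where
  toFun x := (Γ.out_unique s x).choose
  invFun y := (Γ.in_unique s y).choose
  left_inv x := ((Γ.in_unique s _).choose_spec.2 x (Γ.out_unique s x).choose_spec.1).symm
  right_inv y := ((Γ.out_unique s _).choose_spec.2 y (Γ.in_unique s y).choose_spec.1).symm

variable {Γ Δ}

theorem step_eq_iff {s : Fin 2} {x y : Γ.V} : Γ.step s x = y ↔ Γ.E s x y :=
  ⟨fun h => h ▸ (Γ.out_unique s x).choose_spec.1,
    fun h => ((Γ.out_unique s x).choose_spec.2 y h).symm⟩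

theorem E_step (s : Fin 2) (x : Γ.V) : Γ.E s x (Γ.step s x) := step_eq_iff.1 rfl

theorem E_step_symm (s : Fin 2) (x : Γ.V) : Γ.E s ((Γ.step s).symm x) x :=
  step_eq_iff.1 (Equiv.apply_symm_apply _ _)

variable (Γ) in
/-- The word `l` labels a closed walk that starts at the base vertex. -/
def IsLoop (l : List (Fin 2 × Bool)) : Prop := walk Γ.step l Γ.base = Γ.base

/-- Closed walks can be detected after applying a map that commutes with the generators. -/
theorem isLoop_iff {β : Type*} {τ : Fin 2 → Equiv.Perm β} {f : Γ.V → β}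
    (hf : ∀ s x y, Γ.E s x y → τ s (f x) = f y) (hinj : ∀ x, f x = f Γ.base → x = Γ.base)
    (l : List (Fin 2 × Bool)) : Γ.IsLoop l ↔ walk τ l (f Γ.base) = f Γ.base := by
  rw [← map_walk (σ := Γ.step) (fun s x => (hf s x _ (E_step s x)).symm)]
  exact ⟨fun h => congrArg f h, hinj _⟩

theorem exists_walk_eq (v : Γ.V) : ∃ l, walk Γ.step l Γ.base = v := by
  have key (x y : Γ.V) (h : Relation.EqvGen (fun x y => ∃ s, Γ.E s x y) x y) :
      ∃ l, walk Γ.step l x = y := by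
    induction h with
    | rel x y h =>
      obtain ⟨s, h⟩ := h
      exact ⟨[(s, true)], step_eq_iff.2 h⟩
    | refl x => exact ⟨[], rfl⟩
    | symm x y _ ih =>
      obtain ⟨l, rfl⟩ := ih
      exact ⟨invWord l, walk_invWord_walk _ _ _⟩
    | trans x y z _ _ ih ih' =>
      obtain ⟨l, rfl⟩ := ih
      obtain ⟨m, rfl⟩ := ih'
      exact ⟨l ++ m, walk_append _ _ _ _⟩
  exact key _ _ (Γ.connected v)

theorem walk_mem_ball (l : List (Fin 2 × Bool)) : walk Γ.step l Γ.base ∈ Γ.ball l.length := by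
  have := walk_induction (P := fun n x => x ∈ Γ.ball n) (σ := Γ.step) ?_ l (n := 0) (x := Γ.base)
    rfl
  · simpa using this
  · rintro n ⟨s, b⟩ x hx
    refine Or.inr ⟨x, hx, s, ?_⟩
    cases b
    · exact Or.inr (E_step_symm s x)
    · exact Or.inl (E_step s x)

theorem exists_walk_eq_of_mem_ball {n : ℕ} {v : Γ.V} (hv : v ∈ Γ.ball n) :
    ∃ l, l.length ≤ n ∧ walk Γ.step l Γ.base = v := by
  induction n generalizing v with
  | zero => exact ⟨[], le_rfl, (mem_singleton_iff.1 hv).symm⟩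
  | succ n ih =>
    rcases hv with hv | ⟨x, hx, s, h⟩
    · obtain ⟨l, hl, h⟩ := ih hv
      exact ⟨l, by omega, h⟩
    · obtain ⟨l, hl, rfl⟩ := ih hx
      rcases h with h | h
      · exact ⟨l ++ [(s, true)], by simpa using hl, by
          rw [walk_append]; exact step_eq_iff.2 h⟩
      · exact ⟨l ++ [(s, false)], by simpa using hl, by
          rw [walk_append]; exact (Equiv.symm_apply_eq _).2 (step_eq_iff.2 h).symm⟩

theorem Iso.isLoop_iff (h : Γ.Iso Δ) (l : List (Fin 2 × Bool)) : Γ.IsLoop l ↔ Δ.IsLoop l := by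
  obtain ⟨e, hb, hE⟩ := h
  rw [PGraph.isLoop_iff (τ := Δ.step) (f := e) (fun s x y h => step_eq_iff.2 ((hE s x y).1 h))
    (fun x h => e.injective h), hb, IsLoop]

/-- If closed walks agree up to length `N`, so do coincidences between the ends of two walks of
total length at most `N`. -/
theorem walk_eq_walk_iff {N : ℕ} (h : ∀ l, l.length ≤ N → (Γ.IsLoop l ↔ Δ.IsLoop l))
    {l m : List (Fin 2 × Bool)} (hlm : l.length + m.length ≤ N) :
    walk Γ.step l Γ.base = walk Γ.step m Γ.base ↔
      walk Δ.step l Δ.base = walk Δ.step m Δ.base := by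
  rw [← walk_append_invWord_eq_iff, ← walk_append_invWord_eq_iff]
  exact h _ (by simpa using hlm)

/-- A pointed graph is determined by its closed walks. -/
theorem iso_of_isLoop_iff (h : ∀ l, Γ.IsLoop l ↔ Δ.IsLoop l) : Γ.Iso Δ := by
  have key (l m) : walk Γ.step l Γ.base = walk Γ.step m Γ.base ↔
      walk Δ.step l Δ.base = walk Δ.step m Δ.base :=
    walk_eq_walk_iff (N := l.length + m.length) (fun l _ => h l) le_rfl
  choose p hp using fun v : Γ.V => exists_walk_eq v
  choose q hq using fun v : Δ.V => exists_walk_eq v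
  -- A vertex is sent to the end, in the other graph, of a walk with the same word; by `key` the
  -- choice of the word is irrelevant.
  refine ⟨⟨fun v => walk Δ.step (p v) Δ.base, fun v => walk Γ.step (q v) Γ.base, fun v => ?_,
    fun v => ?_⟩, ?_, fun s x y => ?_⟩
  · rw [← hp v, key, hq, hp]
  · dsimp only
    rw [← hq v, ← key, hp, hq]
  · exact (key _ []).1 (hp _)
  · have := key (p x ++ [(s, true)]) (p y)
    rw [walk_append, walk_append, hp, hp] at this
    rw [← step_eq_iff, ← step_eq_iff]
    exact this

/-- A walk of length at most n never leaves the ball, so the isomorphism carries it along edge by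
edge. -/
theorem BallIso.isLoop_iff {n : ℕ} (h : BallIso n Γ Δ) {l : List (Fin 2 × Bool)}
    (hl : l.length ≤ n) : Γ.IsLoop l ↔ Δ.IsLoop l := by
  obtain ⟨f, hf, hb, hE⟩ := h
  have key : ∀ l : List (Fin 2 × Bool), l.length ≤ n →
      f (walk Γ.step l Γ.base) = walk Δ.step l Δ.base := by
    intro l
    induction l using List.reverseRecOn with
    | nil => exact fun _ => hb
    | append_singleton l c ih =>
      intro hl
      have hx := Γ.ball_mono hl (walk_mem_ball (Γ := Γ) (l ++ [c]))
      have hl' : l.length ≤ n := by rw [List.length_append] at hl; omega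
      have hy := Γ.ball_mono hl' (walk_mem_ball (Γ := Γ) l)
      rw [walk_append] at hx ⊢
      rw [walk_append, ← ih hl']
      obtain ⟨s, b⟩ := c
      cases b
      · exact (Equiv.eq_symm_apply _).2 (step_eq_iff.2 ((hE s _ hx _ hy).1 (E_step_symm s _)))
      · exact (step_eq_iff.2 ((hE s _ hy _ hx).1 (E_step s _))).symm
  rw [IsLoop, IsLoop, ← key l hl, ← hb]
  exact (hf.injOn.eq_iff (Γ.ball_mono hl (walk_mem_ball l)) (Γ.base_mem_ball n)).symm

/-- Vertices of the ball are ends of words of length at most n. Comparing two of them takes closed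
walks of length 2n, and testing for an edge between them adds one letter. -/
theorem ballIso_of_isLoop_iff {n : ℕ}
    (h : ∀ l, l.length ≤ 2 * n + 1 → (Γ.IsLoop l ↔ Δ.IsLoop l)) : BallIso n Γ Δ := by
  have hex (v : Γ.V) : ∃ l : List (Fin 2 × Bool), v ∈ Γ.ball n → l.length ≤ n ∧
      walk Γ.step l Γ.base = v := by
    by_cases hv : v ∈ Γ.ball n
    · obtain ⟨l, hl⟩ := exists_walk_eq_of_mem_ball hv
      exact ⟨l, fun _ => hl⟩
    · exact ⟨[], fun h => absurd h hv⟩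
  choose p hp using hex
  refine ⟨fun v => walk Δ.step (p v) Δ.base, ⟨fun x hx => ?_, fun x hx y hy hxy => ?_,
    fun y hy => ?_⟩, ?_, fun s x hx y hy => ?_⟩
  · exact Δ.ball_mono (hp x hx).1 (walk_mem_ball _)
  · have h1 := hp x hx
    have h2 := hp y hy
    rw [← h1.2, ← h2.2]
    exact (walk_eq_walk_iff h (by omega)).2 hxy
  · obtain ⟨l, hl, rfl⟩ := exists_walk_eq_of_mem_ball hy
    have hx := Γ.ball_mono hl (walk_mem_ball (Γ := Γ) l)
    have h1 := hp _ hx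
    exact ⟨_, hx, (walk_eq_walk_iff h (by omega)).1 h1.2⟩
  · have h1 := hp _ (Γ.base_mem_ball n)
    exact (walk_eq_walk_iff h (m := []) (by simp; omega)).1 h1.2
  · have h1 := hp x hx
    have h2 := hp y hy
    have := walk_eq_walk_iff h (l := p x ++ [(s, true)]) (m := p y) (by simp; omega)
    rw [walk_append, walk_append, h1.2, h2.2] at this
    rw [← step_eq_iff, ← step_eq_iff]
    exact this

/-- A pointed graph is in the closure of a family iff its closed walks of bounded length are those
of some member of the family. -/
theorem mem_closure_iff_isLoop {S : Set PGraph} : Γ ∈ closure S ↔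
    ∀ N, ∃ Δ ∈ S, ∀ l : List (Fin 2 × Bool), l.length ≤ N → (Γ.IsLoop l ↔ Δ.IsLoop l) := by
  rw [Metric.mem_closure_iff]
  constructor
  · intro h N
    obtain ⟨Δ, hΔ, hd⟩ := h (2 ^ (-(N : ℤ))) (by positivity)
    exact ⟨Δ, hΔ, fun l hl => ((graphDist_le_iff Γ Δ N).1 hd.le).isLoop_iff hl⟩
  · intro h ε hε
    obtain ⟨n, hn⟩ := exists_pow_lt_of_lt_one hε (by norm_num : (1 / 2 : ℝ) < 1)
    obtain ⟨Δ, hΔ, hl⟩ := h (2 * n + 1)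
    refine ⟨Δ, hΔ, lt_of_le_of_lt ((graphDist_le_iff Γ Δ n).2 (ballIso_of_isLoop_iff hl)) ?_⟩
    rwa [zpow_neg, zpow_natCast, ← inv_pow, ← one_div]

end PGraph

/-! ### Lines over a binary tree -/

section LineStep

variable {U U' : Type*} (e : Bool × U ≃ U) (e' : Bool × U' ≃ U')

/-- The permutations of `U × ℤ` that extend the edges of the limit graphs to an arbitrary set `U`
of grey vertices, where `e (a, g)` is the child of `g` given by the letter `a`. -/
def lineStep : Fin 2 → Equiv.Perm (U × ℤ) :=
  ![{ toFun := fun x => (x.1, x.2 + 1)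
      invFun := fun x => (x.1, x.2 - 1)
      left_inv := fun x => by simp
      right_inv := fun x => by simp },
    { toFun := fun x =>
        if 1 ≤ x.2 then x else if x.2 = 0 then (e (false, x.1), 0)
        else if x.2 = -1 then (e (true, x.1), 0) else (x.1, x.2 + 1)
      -- Position 0 is entered only from the parent's line: from its position 0 or -1, according to
      -- the letter.
      invFun := fun x =>
        if 1 ≤ x.2 then x else if x.2 = 0 then
          ((e.symm x.1).2, if (e.symm x.1).1 = true then -1 else 0)
        else (x.1, x.2 - 1)
      left_inv := fun ⟨g, j⟩ => by
        dsimp only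
        split_ifs <;> simp_all <;> omega
      right_inv := fun ⟨g, j⟩ => by
        dsimp only
        rcases h : e.symm g with ⟨a, h'⟩
        have h2 : e (a, h') = g := by rw [← h, Equiv.apply_symm_apply]
        cases a <;> split_ifs <;> simp_all <;> omega }]

theorem lineStep_zero_apply (x : U × ℤ) : lineStep e 0 x = (x.1, x.2 + 1) := rfl

theorem lineStep_one_apply (x : U × ℤ) : lineStep e 1 x =
    if 1 ≤ x.2 then x else if x.2 = 0 then (e (false, x.1), 0)
    else if x.2 = -1 then (e (true, x.1), 0) else (x.1, x.2 + 1) := rfl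

theorem lineStep_zero_symm_apply (x : U × ℤ) :
    (lineStep e 0).symm x = (x.1, x.2 - 1) := rfl

theorem lineStep_one_symm_apply (x : U × ℤ) : (lineStep e 1).symm x =
    if 1 ≤ x.2 then x else if x.2 = 0 then
      ((e.symm x.1).2, if (e.symm x.1).1 = true then -1 else 0)
    else (x.1, x.2 - 1) := rfl

variable {e e'} in
theorem lineStep_map {f : U → U'} (hf : ∀ a g, f (e (a, g)) = e' (a, f g)) (s : Fin 2)
    (x : U × ℤ) : Prod.map f id (lineStep e s x) = lineStep e' s (Prod.map f id x) := by
  fin_cases s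
  · rfl
  · obtain ⟨g, j⟩ := x
    simp only [Fin.mk_one, lineStep_one_apply, Prod.map, id]
    split_ifs <;> simp [hf]

/-- A step stays at a grey vertex, moves to a child or moves to the parent. -/
theorem walk_lineStep_singleton (c : Fin 2 × Bool) (x : U × ℤ) :
    (walk (lineStep e) [c] x).1 = x.1 ∨ (∃ a, (walk (lineStep e) [c] x).1 = e (a, x.1)) ∨
      (walk (lineStep e) [c] x).1 = (e.symm x.1).2 := by
  obtain ⟨s, b⟩ := c
  fin_cases s <;> cases b <;>
    simp only [walk, Fin.mk_one, Fin.zero_eta, cond_false, cond_true, lineStep_zero_apply,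
      lineStep_one_apply, lineStep_zero_symm_apply, lineStep_one_symm_apply] <;>
    (try split_ifs) <;> simp

end LineStep

/-! ### Comparison with the line graphs -/

/-- The edges of the line graphs. -/
def linePerm (b : Bool) (s : Fin 2) : Equiv.Perm ℤ :=
  if s = 1 ∧ b = false then 1 else Equiv.addRight 1

theorem linePerm_apply (b : Bool) (s : Fin 2) (x : ℤ) :
    linePerm b s x = if s = 1 ∧ b = false then x else x + 1 := by
  unfold linePerm
  split_ifs <;> simp

theorem linePerm_symm_apply (b : Bool) (s : Fin 2) (x : ℤ) :
    (linePerm b s).symm x = if s = 1 ∧ b = false then x else x - 1 := by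
  rw [Equiv.symm_apply_eq, linePerm_apply]
  split_ifs <;> omega

/-- Line graphs are invariant under translation, so closedness may be tested at any j, in particular
at the position of a remote point on another line. -/
theorem lineGraph_isLoop_iff (b : Bool) (l : List (Fin 2 × Bool)) (j : ℤ) :
    (lineGraph b).IsLoop l ↔ walk (linePerm b) l j = j := by
  have := PGraph.isLoop_iff (Γ := lineGraph b) (τ := linePerm b)
    (f := fun i : ℤ => (i + j : ℤ)) (fun s (x y : ℤ) (h : y = _) => ?_)
    (fun x h => add_right_cancel (G := ℤ) h) l
  · simpa [lineGraph] using this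
  · rw [linePerm_apply, h]
    split_ifs <;> omega

section Far

variable {U : Type*} (e : Bool × U ≃ U)

/-- The walk is too short to leave the black vertices, where x₁ acts trivially. -/
theorem walk_lineStep_of_lt (l : List (Fin 2 × Bool)) (g : U) (j : ℤ) (h : (l.length : ℤ) < j) :
    walk (lineStep e) l (g, j) = (g, walk (linePerm false) l j) := by
  induction l generalizing j with
  | nil => rfl
  | cons c l ih =>
    obtain ⟨s, b⟩ := c
    rw [List.length_cons, Nat.cast_succ] at h
    rw [walk_cons, walk_cons (linePerm _)]
    fin_cases s <;> cases b <;>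
      simp only [walk, Fin.mk_one, Fin.zero_eta, cond_false, cond_true, lineStep_zero_apply,
        lineStep_one_apply, lineStep_zero_symm_apply, lineStep_one_symm_apply,
        linePerm_apply, linePerm_symm_apply] <;>
      simp (disch := omega) only [if_pos, zero_ne_one, false_and, if_false, and_self, if_true] <;>
      exact ih _ (by omega)

/-- The extra 1 keeps the walk away from position -1, where x₁ leaves the line; before that, x₁ acts
like x₀. -/
theorem walk_lineStep_of_lt_neg (l : List (Fin 2 × Bool)) (g : U) (j : ℤ)
    (h : j < -(l.length : ℤ) - 1) :
    walk (lineStep e) l (g, j) = (g, walk (linePerm true) l j) := by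
  induction l generalizing j with
  | nil => rfl
  | cons c l ih =>
    obtain ⟨s, b⟩ := c
    rw [List.length_cons, Nat.cast_succ] at h
    rw [walk_cons, walk_cons (linePerm _)]
    fin_cases s <;> cases b <;>
      simp only [walk, Fin.mk_one, Fin.zero_eta, cond_false, cond_true, lineStep_zero_apply,
        lineStep_one_apply, lineStep_zero_symm_apply, lineStep_one_symm_apply,
        linePerm_apply, linePerm_symm_apply] <;>
      simp (disch := omega) only [if_neg, Bool.true_eq_false, and_false, if_false] <;>
      exact ih _ (by omega)

end Far

/-! ### Infinite words, with and without levels -/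

/-- The infinite word `a u`. -/
def consWord (a : Bool) (u : ℕ → Bool) : ℕ → Bool
  | 0 => a
  | n + 1 => u n

/-- Infinite words form a binary tree in which `a u` is a child of `u`. -/
def wordTree : Bool × (ℕ → Bool) ≃ (ℕ → Bool) where
  toFun x := consWord x.1 x.2
  invFun u := (u 0, fun n => u (n + 1))
  left_inv _ := rfl
  right_inv u := by
    funext n
    cases n <;> rfl

/-- The same tree, where the vertices also remember their level. -/
def levelTree : Bool × ((ℕ → Bool) × ℤ) ≃ (ℕ → Bool) × ℤ where
  toFun x := (wordTree (x.1, x.2.1), x.2.2 - 1)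
  invFun x := ((wordTree.symm x.1).1, (wordTree.symm x.1).2, x.2 + 1)
  left_inv x := by simp
  right_inv x := by simp

theorem levelTree_apply (a : Bool) (u : ℕ → Bool) (k : ℤ) :
    levelTree (a, u, k) = (consWord a u, k - 1) := rfl

theorem levelTree_symm_apply (u : ℕ → Bool) (k : ℤ) :
    levelTree.symm (u, k) = (u 0, fun n => u (n + 1), k + 1) := rfl

/-- The last letter `1` of `u` is the `m`-th one. -/
def LastOne (m : ℕ) (u : ℕ → Bool) : Prop := u m = true ∧ ∀ i, m < i → u i = false

theorem LastOne.unique {m m' : ℕ} {u : ℕ → Bool} (h : LastOne m u) (h' : LastOne m' u) :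
    m = m' := by
  rcases lt_trichotomy m m' with h1 | h1 | h1
  · exact absurd h'.1 (by simp [h.2 _ h1])
  · exact h1
  · exact absurd h.1 (by simp [h'.2 _ h1])

theorem LastOne.consWord {m : ℕ} {u : ℕ → Bool} (h : LastOne m u) (a : Bool) :
    LastOne (m + 1) (consWord a u) := by
  refine ⟨h.1, fun i hi => ?_⟩
  obtain ⟨i, rfl⟩ := Nat.exists_eq_add_of_lt (Nat.zero_lt_of_lt hi)
  exact h.2 _ (by omega)

/-- A walk does not see the root of the tree of finite words if it is shorter than the depth. -/
theorem exists_lastOne_walk (l : List (Fin 2 × Bool)) {m : ℕ} (hl : l.length ≤ m)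
    {x : ((ℕ → Bool) × ℤ) × ℤ} (hx : LastOne m x.1.1) :
    ∃ m', LastOne m' (walk (lineStep levelTree) l x).1.1 ∧
      m' + (walk (lineStep levelTree) l x).1.2 = m + x.1.2 := by
  induction l generalizing m x with
  | nil => exact ⟨m, hx, rfl⟩
  | cons c l ih =>
    rw [List.length_cons] at hl
    rw [walk_cons]
    obtain ⟨m₁, hm₁, h1, h2⟩ : ∃ m₁ ≥ l.length,
        LastOne m₁ (walk (lineStep levelTree) [c] x).1.1 ∧
          -- A child pushes the last 1 one place further and lowers the level by one, and the parent
          -- does the opposite, so the sum is invariant.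
          m₁ + (walk (lineStep levelTree) [c] x).1.2 = m + x.1.2 := by
      rcases walk_lineStep_singleton levelTree c x with h | ⟨a, h⟩ | h <;> rw [h]
      · exact ⟨m, by omega, hx, rfl⟩
      · exact ⟨m + 1, by omega, hx.consWord a, by simp only [levelTree, Equiv.coe_fn_mk]; grind⟩
      -- The remaining walk is nonempty, hence m ≥ 1 and the letter dropped on the way to the parent
      -- is not the last 1.
      · obtain ⟨m, rfl⟩ : ∃ m', m = m' + 1 := ⟨m - 1, by omega⟩
        refine ⟨m, by omega, ⟨hx.1, fun i hi => hx.2 _ (by omega)⟩, ?_⟩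
        simp only [levelTree, Equiv.coe_fn_symm_mk]
        grind
    rw [← h2]
    exact ih hm₁ h1

theorem forget_walk (l : List (Fin 2 × Bool)) (u : ℕ → Bool) (k j : ℤ) :
    walk (lineStep wordTree) l (u, j) =
      Prod.map Prod.fst id (walk (lineStep levelTree) l ((u, k), j)) :=
  (map_walk (lineStep_map (e := levelTree) (e' := wordTree) (f := Prod.fst) fun _ _ => rfl) l
    ((u, k), j)).symm

/-- Closed walks that are short compared to the depth preserve the level. -/
theorem walk_wordTree_eq_iff {m : ℕ} {u : ℕ → Bool} (hu : LastOne m u)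
    {l : List (Fin 2 × Bool)} (hl : l.length ≤ m) (j : ℤ) :
    walk (lineStep wordTree) l (u, j) = (u, j) ↔
      walk (lineStep levelTree) l ((u, 0), j) = ((u, 0), j) := by
  rw [forget_walk l u 0 j]
  refine ⟨fun h => ?_, fun h => by rw [h]; rfl⟩
  obtain ⟨m', h1, h2⟩ := exists_lastOne_walk l hl (x := ((u, 0), j)) hu
  rcases hx : walk (lineStep levelTree) l ((u, 0), j) with ⟨⟨u', k⟩, j'⟩
  rw [hx] at h h1 h2
  simp only [Prod.map, id, Prod.mk.injEq] at h
  obtain ⟨rfl, rfl⟩ := h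
  have := h1.unique hu
  simp only at h2
  rw [show k = 0 by omega]

/-- Far letters are only shifted by the level. -/
theorem walk_levelTree_tail (l : List (Fin 2 × Bool)) (u : ℕ → Bool) (j : ℤ) {i k : ℕ}
    (hi : l.length ≤ i) (hk : (k : ℤ) = i + (walk (lineStep levelTree) l ((u, 0), j)).1.2) :
    (walk (lineStep levelTree) l ((u, 0), j)).1.1 i = u k := by
  -- After n steps at most the first n letters have been written by the walk; the others are letters
  -- of u, shifted by the level.
  have := walk_induction (σ := lineStep levelTree)
    (P := fun n x => ∀ i k : ℕ, n ≤ i → (k : ℤ) = i + x.1.2 → x.1.1 i = u k) ?_ l (n := 0)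
    (x := ((u, 0), j)) ?_
  · exact this i k (by omega) hk
  · intro n c x hx i k hi hk
    rcases walk_lineStep_singleton levelTree c x with h | ⟨a, h⟩ | h <;> rw [h] at hk ⊢
    · exact hx i k (by omega) hk
    · obtain ⟨i, rfl⟩ := Nat.exists_eq_add_of_lt (Nat.zero_lt_of_lt hi)
      refine hx (0 + i) k (by omega) ?_
      simp only [levelTree, Equiv.coe_fn_mk] at hk
      push_cast at hk ⊢
      omega
    · refine hx (i + 1) k (by omega) ?_
      simp only [levelTree, Equiv.coe_fn_symm_mk] at hk
      push_cast at hk ⊢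
      omega
  · intro i k _ hk
    have : k = i := by simpa using hk
    rw [this]

/-- Walks from words with a common prefix run in parallel. -/
theorem walk_levelTree_prefix (l : List (Fin 2 × Bool)) {M : ℕ} {u w : ℕ → Bool} (k j : ℤ)
    (h : ∀ i < M + l.length, u i = w i) :
    (walk (lineStep levelTree) l ((u, k), j)).1.2 =
        (walk (lineStep levelTree) l ((w, k), j)).1.2 ∧
      (walk (lineStep levelTree) l ((u, k), j)).2 =
        (walk (lineStep levelTree) l ((w, k), j)).2 ∧
      ∀ i < M, (walk (lineStep levelTree) l ((u, k), j)).1.1 i =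
        (walk (lineStep levelTree) l ((w, k), j)).1.1 i := by
  induction l generalizing u w k j with
  | nil => exact ⟨rfl, rfl, h⟩
  | cons c l ih =>
    rw [List.length_cons, ← add_assoc] at h
    rw [walk_cons, walk_cons (x := ((w, k), j))]
    -- Only the first letter can influence a step, through x₁⁻¹ at position 0. Since it is common,
    -- both walks take the same branch.
    obtain ⟨a, hu0, hw0⟩ : ∃ a, u 0 = a ∧ w 0 = a := ⟨u 0, rfl, (h 0 (by omega)).symm⟩
    have hcons (a : Bool) : ∀ i < M + l.length, consWord a u i = consWord a w i := by
      rintro (_ | i) hi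
      · rfl
      · exact h i (by omega)
    have htail : ∀ i < M + l.length, u (i + 1) = w (i + 1) := fun i hi => h _ (by omega)
    have hself : ∀ i < M + l.length, u i = w i := fun i hi => h _ (by omega)
    obtain ⟨s, b⟩ := c
    fin_cases s <;> cases b <;>
      simp only [walk, Fin.mk_one, Fin.zero_eta, cond_false, cond_true,
        lineStep_zero_apply, lineStep_one_apply, lineStep_zero_symm_apply,
        lineStep_one_symm_apply, levelTree_apply, levelTree_symm_apply, hu0, hw0] <;>
      try split_ifs
    all_goals first | exact ih _ _ hself | exact ih _ _ (hcons _) | exact ih _ _ htail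

/-- Each step may consume one common letter, so of 2|l| letters at least |l| remain to compare the
first |l| letters of the end. The later ones are untouched since the level has returned to 0. -/
theorem walk_levelTree_eq_of_prefix {l : List (Fin 2 × Bool)} {u w : ℕ → Bool} (j : ℤ)
    (h : ∀ i < 2 * l.length, u i = w i)
    (hu : walk (lineStep levelTree) l ((u, 0), j) = ((u, 0), j)) :
    walk (lineStep levelTree) l ((w, 0), j) = ((w, 0), j) := by
  obtain ⟨h1, h2, h3⟩ := walk_levelTree_prefix l (M := l.length) 0 j (by rwa [← two_mul])
  have h4 := fun i => walk_levelTree_tail l w j (i := i) (k := i)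
  rw [hu] at h1 h2 h3
  refine Prod.ext (Prod.ext (funext fun i => ?_) h1.symm) h2.symm
  rcases lt_or_ge i l.length with hi | hi
  · rw [← h3 i hi]
    exact h i (by omega)
  · exact h4 i hi (by rw [← h1]; simp)

theorem walk_levelTree_eq_iff_of_prefix {l : List (Fin 2 × Bool)} {u w : ℕ → Bool} (j : ℤ)
    (h : ∀ i < 2 * l.length, u i = w i) :
    walk (lineStep levelTree) l ((u, 0), j) = ((u, 0), j) ↔
      walk (lineStep levelTree) l ((w, 0), j) = ((w, 0), j) :=
  ⟨walk_levelTree_eq_of_prefix j h,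
    walk_levelTree_eq_of_prefix j fun i hi => (h i hi).symm⟩

/-! ### Closed walks of the upward graphs -/

/-- The infinite word and the level of a grey vertex of the graph with upward path `w`. -/
def Grey.label (w : ℕ → Bool) : Grey → (ℕ → Bool) × ℤ
  | below v => v.foldr (fun a x => levelTree (a, x)) (w, 0)
  | above k => (fun i => w (i + (k + 1)), k + 1)
  | side k v => v.foldr (fun a x => levelTree (a, x))
      (levelTree (!w k, fun i => w (i + (k + 1)), k + 1))

/-- This makes the label a morphism of trees, so that it carries limit steps to `lineStep
levelTree`. -/
theorem Grey.label_child (w : ℕ → Bool) (a : Bool) (g : Grey) :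
    (g.child w a).label w = levelTree (a, g.label w) := by
  rcases g with v | k | ⟨k, v⟩
  · rfl
  · by_cases h : a = w k
    · subst h
      rw [child, if_pos rfl, label, levelTree_apply]
      refine Prod.ext (funext fun i => ?_) ?_
      · cases k <;> cases i <;> simp [spine, label, consWord]
        congr 1
        omega
      · cases k <;> simp [spine, label]
    · have h' : a = !w k := by revert h; cases a <;> cases w k <;> simp
      rw [child, if_neg h, h']
      rfl
  · rfl

theorem Grey.label_below_snd (w : ℕ → Bool) (v : List Bool) :
    ((below v).label w).2 = -(v.length : ℤ) := by
  induction v with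
  | nil => rfl
  | cons a v ih =>
    rw [show (below (a :: v)).label w = levelTree (a, (below v).label w) from rfl,
      levelTree_apply, ih, List.length_cons]
    push_cast
    ring

theorem Grey.label_side (w : ℕ → Bool) (k : ℕ) (v : List Bool) :
    ((side k v).label w).2 = k - (v.length : ℤ) ∧ ((side k v).label w).1 v.length = !w k := by
  induction v with
  | nil => exact ⟨by simp [label, levelTree_apply], rfl⟩
  | cons a v ih =>
    rw [show (side k (a :: v)).label w = levelTree (a, (side k v).label w) from rfl,
      levelTree_apply, ih.1, List.length_cons]
    refine ⟨by push_cast; ring, ih.2⟩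

/-- At level 0, a vertex below the base has an empty word, and no `above` vertex occurs. A vertex
`side k v` has v of length k, and its k-th letter is the wrong turn `!w k`. Injectivity at the base
is all that detecting closed walks requires. -/
theorem Grey.eq_of_label_eq (w : ℕ → Bool) {g : Grey} (h : g.label w = (w, 0)) :
    g = spine 0 := by
  rcases g with v | k | ⟨k, v⟩
  · have := label_below_snd w v
    rw [h] at this
    have h0 : v.length = 0 := by simpa using this.symm
    rw [List.length_eq_zero_iff.1 h0, spine]
  · rw [label, Prod.ext_iff] at h
    have := h.2
    simp only at this
    omega
  · obtain ⟨h1, h2⟩ := label_side w k v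
    rw [h] at h1 h2
    have : v.length = k := by simp only at h1; omega
    rw [this] at h2
    simp at h2

theorem upwardGraph_isLoop_iff (w : ℕ → Bool) (j : ℤ) (l : List (Fin 2 × Bool)) :
    (upwardGraph w j).IsLoop l ↔ walk (lineStep levelTree) l ((w, 0), j) = ((w, 0), j) := by
  refine PGraph.isLoop_iff (Γ := upwardGraph w j) (τ := lineStep levelTree)
    (f := Prod.map (Grey.label w) id)
    (fun s x y h => ?_) (fun x h => ?_) l
  · obtain ⟨g, i⟩ := x
    change limitStep w s (g, i) = y at h
    rw [← h]
    fin_cases s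
    · rfl
    · simp only [Fin.mk_one, lineStep_one_apply, limitStep, Prod.map, id]
      split_ifs <;> simp only [Grey.label_child]
  · obtain ⟨g, i⟩ := x
    change (g.label w, i) = ((w, 0), j) at h
    rw [Prod.mk.injEq] at h
    exact Prod.ext (Grey.eq_of_label_eq w h.1) h.2

/-! ### Points of the unit interval from infinite words -/

/-- The number with binary digits `u`. -/
noncomputable def binaryValue (u : ℕ → Bool) : ℝ := Cardinal.cantorFunction (1 / 2) u / 2

theorem binaryValue_eq (u : ℕ → Bool) :
    binaryValue u = ((if u 0 = true then 1 else 0) + binaryValue fun n => u (n + 1)) / 2 := by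
  unfold binaryValue
  rw [Cardinal.cantorFunction_succ u (by norm_num) (by norm_num)]
  cases u 0 <;> simp <;> ring

theorem binaryValue_consWord (a : Bool) (u : ℕ → Bool) :
    binaryValue (consWord a u) = ((if a = true then 1 else 0) + binaryValue u) / 2 :=
  binaryValue_eq _

theorem binaryValue_const (a : Bool) :
    binaryValue (fun _ => a) = if a = true then 1 else 0 := by
  -- A constant word is its own tail, so its value solves x = (a + x) / 2.
  have := binaryValue_eq fun _ => a
  linarith

theorem binaryValue_mono {u v : ℕ → Bool} (h : ∀ n, u n → v n) :
    binaryValue u ≤ binaryValue v :=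
  div_le_div_of_nonneg_right
    (Cardinal.cantorFunction_le (by norm_num) (by norm_num) h) (by norm_num)

theorem binaryValue_nonneg (u : ℕ → Bool) : 0 ≤ binaryValue u := by
  simpa [binaryValue_const] using binaryValue_mono (u := fun _ => false) (v := u) (by simp)

theorem binaryValue_le_one (u : ℕ → Bool) : binaryValue u ≤ 1 := by
  simpa [binaryValue_const] using binaryValue_mono (u := u) (v := fun _ => true) (by simp)

/-- The word `u` ends with infinitely many letters `0`. -/
def IsFiniteWord (u : ℕ → Bool) : Prop := ∃ m, ∀ i, m ≤ i → u i = false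

theorem IsFiniteWord.tail {u : ℕ → Bool} (h : IsFiniteWord u) :
    IsFiniteWord fun n => u (n + 1) :=
  h.imp fun _ hm _ hi => hm _ (by omega)

theorem IsFiniteWord.cons {u : ℕ → Bool} (h : IsFiniteWord u) (a : Bool) :
    IsFiniteWord (consWord a u) := by
  obtain ⟨m, hm⟩ := h
  refine ⟨m + 1, fun i hi => ?_⟩
  obtain ⟨i, rfl⟩ : ∃ i', i = i' + 1 := ⟨i - 1, by omega⟩
  exact hm i (by omega)

theorem LastOne.isFiniteWord {m : ℕ} {u : ℕ → Bool} (h : LastOne m u) : IsFiniteWord u :=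
  ⟨m + 1, fun i hi => h.2 i hi⟩

theorem IsFiniteWord.lt_one_and_isDyadic {u : ℕ → Bool} (h : IsFiniteWord u) :
    binaryValue u < 1 ∧ IsDyadic (binaryValue u) := by
  obtain ⟨m, hm⟩ := h
  induction m generalizing u with
  | zero =>
    have : u = fun _ => false := funext fun i => hm i (Nat.zero_le i)
    rw [this, binaryValue_const]
    exact ⟨by simp, 0, 0, by simp⟩
  | succ m ih =>
    obtain ⟨h1, h2⟩ := ih (u := fun n => u (n + 1)) fun i hi => hm _ (by omega)
    rw [binaryValue_eq]
    refine ⟨by split_ifs <;> linarith, ?_⟩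
    have h3 : IsDyadic (if u 0 = true then 1 else 0) := by
      split_ifs
      · exact ⟨1, 0, by simp⟩
      · exact ⟨0, 0, by simp⟩
    have := (h3.add h2).zpow_mul (-1)
    rw [div_eq_inv_mul]
    simpa using this

/-- Tails of finite words have values in [0,1), never 1. The value therefore determines the first
digit and the value of the tail. -/
theorem IsFiniteWord.eq_of_binaryValue_eq {u v : ℕ → Bool} (hu : IsFiniteWord u)
    (hv : IsFiniteWord v) (h : binaryValue u = binaryValue v) : u = v := by
  have key {u v : ℕ → Bool} (hu : IsFiniteWord u) (hv : IsFiniteWord v)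
      (h : binaryValue u = binaryValue v) : u 0 = v 0 ∧
        (binaryValue fun n => u (n + 1)) = binaryValue fun n => v (n + 1) := by
    have h1 := hu.tail.lt_one_and_isDyadic.1
    have h2 := hv.tail.lt_one_and_isDyadic.1
    have h3 := binaryValue_nonneg fun n => u (n + 1)
    have h4 := binaryValue_nonneg fun n => v (n + 1)
    rw [binaryValue_eq u, binaryValue_eq v] at h
    cases hu0 : u 0 <;> cases hv0 : v 0 <;> simp only [hu0, hv0, if_true] at h <;>
      simp at h ⊢ <;> linarith
  funext i
  induction i generalizing u v with
  | zero => exact (key hu hv h).1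
  | succ i ih => exact ih hu.tail hv.tail (key hu hv h).2

/-! ### The generators in the coordinates of words and positions -/

/-- The point of the unit interval with binary expansion `0^j 1 u` if `j ≥ 1` and `1^(1-j) 0 u` if
`j ≤ 0`, in terms of the number `v` with binary digits `u`. -/
noncomputable def linePoint (v : ℝ) (j : ℤ) : ℝ :=
  if 1 ≤ j then 2 ^ (-j - 1) * (1 + v) else 1 - 2 ^ (j - 2) * (2 - v)

theorem two_zpow_le {j : ℤ} {a : ℤ} (h : j ≤ a) : (2 : ℝ) ^ j ≤ 2 ^ a :=
  zpow_le_zpow_right₀ (by norm_num) h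

/-- For v in [0,1] the positions j correspond to dyadic intervals that tile (0,1) and move to the
left as j grows. -/
theorem linePoint_bounds {v : ℝ} (h0 : 0 ≤ v) (h1 : v ≤ 1) (j : ℤ) :
    (1 ≤ j → 2 ^ (-j - 1) ≤ linePoint v j ∧ linePoint v j ≤ 2 ^ (-j)) ∧
      (j ≤ 0 → 1 - 2 ^ (j - 1) ≤ linePoint v j ∧ linePoint v j ≤ 1 - 2 ^ (j - 2)) := by
  unfold linePoint
  constructor <;> intro hj
  · rw [if_pos hj]
    have h : (2 : ℝ) ^ (-j) = 2 ^ (-j - 1) * 2 := by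
      rw [← zpow_add_one₀ (by norm_num), sub_add_cancel]
    have hp : (0 : ℝ) < 2 ^ (-j - 1) := by positivity
    rw [h]
    constructor <;> nlinarith
  · rw [if_neg (by omega)]
    have h : (2 : ℝ) ^ (j - 1) = 2 ^ (j - 2) * 2 := by
      rw [← zpow_add_one₀ (by norm_num)]
      congr 1
      ring
    have hp : (0 : ℝ) < 2 ^ (j - 2) := by positivity
    rw [h]
    constructor <;> nlinarith

theorem linePoint_mem_Ioo {v : ℝ} (h0 : 0 ≤ v) (h1 : v ≤ 1) (j : ℤ) :
    0 < linePoint v j ∧ linePoint v j < 1 := by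
  obtain ⟨hb1, hb2⟩ := linePoint_bounds h0 h1 j
  rcases le_or_gt 1 j with hj | hj
  · refine ⟨lt_of_lt_of_le (by positivity) (hb1 hj).1, lt_of_le_of_lt (hb1 hj).2 ?_⟩
    exact zpow_lt_one_of_neg₀ (by norm_num) (by omega)
  · have h2 := hb2 (by omega)
    have h3 : (2 : ℝ) ^ (j - 1) < 1 := zpow_lt_one_of_neg₀ (by norm_num) (by omega)
    have h4 : (0 : ℝ) < 2 ^ (j - 2) := by positivity
    exact ⟨by linarith, by linarith⟩

/-- Excluding v = 1 makes the intervals half-open, hence disjoint, so the point determines j; for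
fixed j the point is a nonconstant affine function of v. -/
theorem linePoint_injective {v v' : ℝ} (h0 : 0 ≤ v) (h1 : v < 1) (h0' : 0 ≤ v') (h1' : v' < 1)
    {j j' : ℤ} (h : linePoint v j = linePoint v' j') : v = v' ∧ j = j' := by
  have low {v : ℝ} (h0 : 0 ≤ v) (h1 : v < 1) {j : ℤ} (hj : 1 ≤ j) :
      2 ^ (-j - 1) ≤ linePoint v j ∧ linePoint v j < 2 ^ (-j) := by
    refine ⟨((linePoint_bounds h0 h1.le j).1 hj).1, ?_⟩
    rw [linePoint, if_pos hj, show -j = (-j - 1) + 1 by ring, zpow_add_one₀ (by norm_num),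
      show (-j - 1) + 1 - 1 = -j - 1 by ring]
    have hp : (0 : ℝ) < 2 ^ (-j - 1) := by positivity
    nlinarith
  have high {v : ℝ} (h0 : 0 ≤ v) (h1 : v < 1) {j : ℤ} (hj : j ≤ 0) :
      1 - 2 ^ (j - 1) ≤ linePoint v j ∧ linePoint v j < 1 - 2 ^ (j - 2) := by
    refine ⟨((linePoint_bounds h0 h1.le j).2 hj).1, ?_⟩
    rw [linePoint, if_neg (by omega)]
    have hp : (0 : ℝ) < 2 ^ (j - 2) := by positivity
    nlinarith
  have half {j : ℤ} (hj : j ≤ -1) : (2 : ℝ) ^ j ≤ 1 / 2 := by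
    simpa using two_zpow_le hj
  have hjj : j = j' := by
    rcases le_or_gt 1 j with hj | hj <;> rcases le_or_gt 1 j' with hj' | hj'
    · have b := low h0 h1 hj
      have b' := low h0' h1' hj'
      by_contra hne
      rcases lt_or_gt_of_ne hne with hlt | hlt
      · have := two_zpow_le (show -j' ≤ -j - 1 by omega)
        linarith
      · have := two_zpow_le (show -j ≤ -j' - 1 by omega)
        linarith
    · have b := low h0 h1 hj
      have b' := high h0' h1' (show j' ≤ 0 by omega)
      have := half (show -j ≤ -1 by omega)
      have := half (show j' - 1 ≤ -1 by omega)
      linarith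
    · have b := high h0 h1 (show j ≤ 0 by omega)
      have b' := low h0' h1' hj'
      have := half (show j - 1 ≤ -1 by omega)
      have := half (show -j' ≤ -1 by omega)
      linarith
    · have b := high h0 h1 (show j ≤ 0 by omega)
      have b' := high h0' h1' (show j' ≤ 0 by omega)
      by_contra hne
      rcases lt_or_gt_of_ne hne with hlt | hlt
      · have := two_zpow_le (show j - 1 ≤ j' - 2 by omega)
        linarith
      · have := two_zpow_le (show j' - 1 ≤ j - 2 by omega)
        linarith
  subst hjj
  refine ⟨?_, rfl⟩
  unfold linePoint at h
  split_ifs at h with hj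
  · have hp : (2 : ℝ) ^ (-j - 1) ≠ 0 := by positivity
    linarith [mul_left_cancel₀ hp h]
  · have hp : (2 : ℝ) ^ (j - 2) ≠ 0 := by positivity
    linarith [mul_left_cancel₀ hp (sub_right_injective h)]

theorem isDyadic_linePoint {v : ℝ} (hv : IsDyadic v) (j : ℤ) : IsDyadic (linePoint v j) := by
  have h1 : IsDyadic 1 := ⟨1, 0, by simp⟩
  have h2 : IsDyadic 2 := ⟨2, 0, by simp⟩
  unfold linePoint
  split_ifs
  · exact (h1.add hv).zpow_mul _
  · exact h1.sub ((h2.sub hv).zpow_mul _)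

/-- The break points 1/2 and 3/4 are end points of the intervals, and x₀ maps each interval affinely
onto the next. -/
theorem x0Fun_linePoint {v : ℝ} (h0 : 0 ≤ v) (h1 : v ≤ 1) (j : ℤ) :
    x0Fun (linePoint v j) = linePoint v (j + 1) := by
  obtain ⟨hb1, hb2⟩ := linePoint_bounds h0 h1 j
  rcases lt_trichotomy j 0 with hj | rfl | hj
  · have hb := hb2 hj.le
    have h3 : (2 : ℝ) ^ (j - 1) ≤ 1 / 4 := by
      have := two_zpow_le (show j - 1 ≤ -2 by omega)
      norm_num at this ⊢
      exact this
    have h4 : x0Fun (linePoint v j) = 2 * linePoint v j - 1 := by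
      unfold x0Fun
      split_ifs <;> linarith
    rw [h4, linePoint, linePoint, if_neg (by omega), if_neg (by omega),
      show j + 1 - 2 = j - 2 + 1 by ring, zpow_add_one₀ (by norm_num)]
    ring
  · have e : linePoint v 0 = 1 / 2 + v / 4 := by norm_num [linePoint]; ring
    have e' : linePoint v (0 + 1) = 1 / 4 + v / 4 := by norm_num [linePoint]; ring
    rw [e, e']
    unfold x0Fun
    split_ifs <;> linarith
  · have hb := hb1 hj
    have h3 : (2 : ℝ) ^ (-j) ≤ 1 / 2 := by simpa using two_zpow_le (show -j ≤ -1 by omega)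
    rw [x0Fun, if_pos (by linarith), linePoint, linePoint, if_pos (by omega), if_pos (by omega),
      show -j - 1 = -(j + 1) - 1 + 1 by ring, zpow_add_one₀ (by norm_num)]
    ring

/-- The intervals of the positions 0 and -1 are [1/2, 3/4] and [3/4, 7/8]. They are mapped to the
left and the right half of [1/2, 3/4], which prepends the letter 0 or 1 to the digits of v. -/
theorem x1Fun_linePoint {v : ℝ} (h0 : 0 ≤ v) (h1 : v ≤ 1) (j : ℤ) :
    x1Fun (linePoint v j) = if 1 ≤ j then linePoint v j else if j = 0 then linePoint (v / 2) 0
      else if j = -1 then linePoint ((1 + v) / 2) 0 else linePoint v (j + 1) := by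
  obtain ⟨hb1, hb2⟩ := linePoint_bounds h0 h1 j
  have e (v : ℝ) : linePoint v 0 = 1 / 2 + v / 4 := by norm_num [linePoint]; ring
  split_ifs with hj hj' hj'
  · have hb := hb1 hj
    have h3 : (2 : ℝ) ^ (-j) ≤ 1 / 2 := by simpa using two_zpow_le (show -j ≤ -1 by omega)
    rw [x1Fun, if_pos (by linarith)]
  · rw [hj', e, e]
    unfold x1Fun
    split_ifs <;> linarith
  · have e' : linePoint v (-1) = 3 / 4 + v / 8 := by norm_num [linePoint]; ring
    rw [hj', e, e']
    unfold x1Fun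
    split_ifs <;> linarith
  · have hb := hb2 (by omega)
    have h3 : (2 : ℝ) ^ (j - 1) ≤ 1 / 8 := by
      have := two_zpow_le (show j - 1 ≤ -3 by omega)
      norm_num at this ⊢
      exact this
    have h4 : x1Fun (linePoint v j) = 2 * linePoint v j - 1 := by
      unfold x1Fun
      split_ifs <;> linarith
    rw [h4, linePoint, linePoint, if_neg (by omega), if_neg (by omega),
      show j + 1 - 2 = j - 2 + 1 by ring, zpow_add_one₀ (by norm_num)]
    ring

/-- The point of the unit interval at position `j` of the line of the word `u`. -/
noncomputable def wordPoint (x : (ℕ → Bool) × ℤ) : unitInterval :=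
  ⟨linePoint (binaryValue x.1) x.2,
    have h := linePoint_mem_Ioo (binaryValue_nonneg x.1) (binaryValue_le_one x.1) x.2
    ⟨h.1.le, h.2.le⟩⟩

theorem wordPoint_injective {x y : (ℕ → Bool) × ℤ} (hx : IsFiniteWord x.1)
    (hy : IsFiniteWord y.1) (h : wordPoint x = wordPoint y) : x = y := by
  obtain ⟨h1, h2⟩ := linePoint_injective (binaryValue_nonneg _) hx.lt_one_and_isDyadic.1
    (binaryValue_nonneg _) hy.lt_one_and_isDyadic.1 (Subtype.ext_iff.1 h)
  exact Prod.ext (hx.eq_of_binaryValue_eq hy h1) h2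

/-- The generators of `F` as permutations of the unit interval. -/
noncomputable def genPerm (s : Fin 2) : Equiv.Perm unitInterval := MulAction.toPerm (gen s)

/-- The equivariance behind the whole translation. It holds for all words; finiteness only matters
for the injectivity of the coordinates. -/
theorem wordPoint_lineStep (s : Fin 2) (x : (ℕ → Bool) × ℤ) :
    wordPoint (lineStep wordTree s x) = genPerm s (wordPoint x) := by
  have h0 := binaryValue_nonneg x.1
  have h1 := binaryValue_le_one x.1
  apply Subtype.ext
  fin_cases s
  · exact (x0Fun_linePoint h0 h1 x.2).symm
  · refine Eq.trans ?_ (x1Fun_linePoint h0 h1 x.2).symm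
    rw [Fin.mk_one, lineStep_one_apply]
    split_ifs
    · rfl
    · change linePoint (binaryValue (consWord false x.1)) 0 = _
      simp [binaryValue_consWord]
    · change linePoint (binaryValue (consWord true x.1)) 0 = _
      simp [binaryValue_consWord]
    · rfl

theorem wordPoint_walk (l : List (Fin 2 × Bool)) (x : (ℕ → Bool) × ℤ) :
    wordPoint (walk (lineStep wordTree) l x) = walk genPerm l (wordPoint x) :=
  map_walk wordPoint_lineStep l x

theorem isFiniteWord_walk (l : List (Fin 2 × Bool)) {x : (ℕ → Bool) × ℤ}
    (hx : IsFiniteWord x.1) : IsFiniteWord (walk (lineStep wordTree) l x).1 := by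
  refine walk_induction (σ := lineStep wordTree) (P := fun _ x => IsFiniteWord x.1) ?_ l (n := 0)
    hx
  intro n c x hx
  rcases walk_lineStep_singleton wordTree c x with h | ⟨a, h⟩ | h <;> rw [h]
  · exact hx
  · exact hx.cons a
  · exact hx.tail

theorem walk_genPerm_wordPoint_eq_iff (l : List (Fin 2 × Bool)) {x : (ℕ → Bool) × ℤ}
    (hx : IsFiniteWord x.1) : walk genPerm l (wordPoint x) = wordPoint x ↔
      walk (lineStep wordTree) l x = x := by
  rw [← wordPoint_walk]
  exact ⟨wordPoint_injective (isFiniteWord_walk l hx) hx, congrArg _⟩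

/-- The point of a finite word as a dyadic rational number. -/
noncomputable def IsFiniteWord.dyadicPoint {u : ℕ → Bool} (hu : IsFiniteWord u) (j : ℤ) :
    DyadicPoint :=
  ⟨wordPoint (u, j), isDyadic_linePoint hu.lt_one_and_isDyadic.2 j,
    linePoint_mem_Ioo (binaryValue_nonneg u) (binaryValue_le_one u) j⟩

theorem exists_walk_genPerm {g : thompsonF} (hg : g ∈ Subgroup.closure (Set.range gen)) :
    ∃ l, ∀ t : unitInterval, g • t = walk genPerm l t := by
  induction hg using Subgroup.closure_induction with
  | mem x hx =>
    obtain ⟨s, rfl⟩ := hx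
    exact ⟨[(s, true)], fun _ => rfl⟩
  | one => exact ⟨[], fun t => one_smul _ t⟩
  | mul x y _ _ hx hy =>
    obtain ⟨l, hl⟩ := hx
    obtain ⟨m, hm⟩ := hy
    -- Walks read their words from left to right, whereas y acts first in the product.
    exact ⟨m ++ l, fun t => by rw [mul_smul, walk_append, hl, hm]⟩
  | inv x _ hx =>
    obtain ⟨l, hl⟩ := hx
    refine ⟨invWord l, fun t => ?_⟩
    rw [inv_smul_eq_iff, hl]
    have := walk_invWord_walk genPerm (invWord l) t
    rwa [show invWord (invWord l) = l by simp [invWord, Function.comp_def], eq_comm] at this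

/-- Every dyadic rational number in `(0,1)` comes from a finite word. -/
theorem DyadicPoint.exists_wordPoint_eq (q : DyadicPoint) :
    ∃ u j, IsFiniteWord u ∧ wordPoint (u, j) = q.1 := by
  have h0 : IsFiniteWord fun _ => false := ⟨0, fun _ _ => rfl⟩
  -- By transitivity a walk leads to q from the point 1/2 of the zero word, and walks preserve
  -- finiteness of words.
  obtain ⟨g, hg, h⟩ := (h0.dyadicPoint 0).exists_smul_eq q
  obtain ⟨l, hl⟩ := exists_walk_genPerm hg
  refine ⟨_, (walk (lineStep wordTree) l (fun _ => false, 0)).2,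
    isFiniteWord_walk l (x := (fun _ => false, 0)) h0, ?_⟩
  rw [Prod.mk.eta, wordPoint_walk, ← h, hl]
  rfl

/-- The closed walks of a Schreier graph, with an arbitrary base vertex of the orbit. -/
theorem schreierGraph_rebase_isLoop_iff (q : DyadicPoint) (v : (schreierGraph q).V)
    (l : List (Fin 2 × Bool)) :
    ((schreierGraph q).rebase v).IsLoop l ↔ walk genPerm l v.1 = v.1 :=
  PGraph.isLoop_iff (Γ := (schreierGraph q).rebase v) (τ := genPerm) (f := Subtype.val)
    (fun _ _ _ h => congrArg Subtype.val h) (fun _ h => Subtype.ext h) l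

theorem schreierGraph_isLoop_iff (q : DyadicPoint) (l : List (Fin 2 × Bool)) :
    (schreierGraph q).IsLoop l ↔ walk genPerm l q.1 = q.1 :=
  schreierGraph_rebase_isLoop_iff q ⟨q.1, MulAction.mem_orbit_self _⟩ l

theorem schreierGraph_isLoop_iff_word {q : DyadicPoint} {u : ℕ → Bool} {j : ℤ}
    (hu : IsFiniteWord u) (hq : wordPoint (u, j) = q.1) (l : List (Fin 2 × Bool)) :
    (schreierGraph q).IsLoop l ↔ walk (lineStep wordTree) l (u, j) = (u, j) := by
  rw [schreierGraph_isLoop_iff, ← hq, walk_genPerm_wordPoint_eq_iff l hu]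

/-! ### The closure of the family of Schreier graphs -/

/-- From here on the closure is a question about walks on finite words only. -/
theorem mem_closure_dyadicFamily_iff {Γ : PGraph} : Γ ∈ closure dyadicFamily ↔
    ∀ N, ∃ u j, IsFiniteWord u ∧ ∀ l : List (Fin 2 × Bool), l.length ≤ N →
      (Γ.IsLoop l ↔ walk (lineStep wordTree) l (u, j) = (u, j)) := by
  rw [PGraph.mem_closure_iff_isLoop]
  refine forall_congr' fun N => ⟨?_, ?_⟩
  · rintro ⟨_, ⟨q, rfl⟩, h⟩
    obtain ⟨u, j, hu, hq⟩ := q.exists_wordPoint_eq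
    exact ⟨u, j, hu, fun l hl => (h l hl).trans (schreierGraph_isLoop_iff_word hu hq l)⟩
  · rintro ⟨u, j, hu, h⟩
    exact ⟨_, ⟨hu.dyadicPoint j, rfl⟩, fun l hl =>
      (h l hl).trans (schreierGraph_isLoop_iff_word hu rfl l).symm⟩

theorem mem_closure_of_iso_rebase {Γ : PGraph} {q : DyadicPoint} {v : (schreierGraph q).V}
    (h : Γ.Iso ((schreierGraph q).rebase v)) : Γ ∈ closure dyadicFamily := by
  rw [mem_closure_dyadicFamily_iff]
  intro N
  obtain ⟨v, g, rfl⟩ := v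
  obtain ⟨u, j, hu, hq⟩ := (q.map g).exists_wordPoint_eq
  refine ⟨u, j, hu, fun l _ => ?_⟩
  rw [h.isLoop_iff, ← walk_genPerm_wordPoint_eq_iff l hu, hq]
  exact schreierGraph_rebase_isLoop_iff q _ l

theorem mem_closure_of_iso_upwardGraph {Γ : PGraph} {w : ℕ → Bool} {j : ℤ}
    (h : Γ.Iso (upwardGraph w j)) : Γ ∈ closure dyadicFamily := by
  rw [mem_closure_dyadicFamily_iff]
  intro N
  -- The prefix of length 2N is long enough for closed walks of length N. The 1 placed after it
  -- guarantees the depth even if w has only zeros from some point on.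
  have hu : LastOne (2 * N) fun i => if i < 2 * N then w i else decide (i = 2 * N) := by
    refine ⟨by simp, fun i hi => ?_⟩
    simp only
    rw [if_neg (by omega), decide_eq_false (by omega)]
  refine ⟨_, j, hu.isFiniteWord, fun l hl => ?_⟩
  rw [h.isLoop_iff, upwardGraph_isLoop_iff, walk_wordTree_eq_iff hu (by omega)]
  refine (walk_levelTree_eq_iff_of_prefix j fun i hi => ?_).symm
  rw [if_pos (by omega)]

theorem mem_closure_of_iso_lineGraph {Γ : PGraph} {b : Bool} (h : Γ.Iso (lineGraph b)) :
    Γ ∈ closure dyadicFamily := by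
  rw [mem_closure_dyadicFamily_iff]
  intro N
  have h0 : IsFiniteWord fun _ => false := ⟨0, fun _ _ => rfl⟩
  cases b
  -- The positions N + 1 and -N - 2 are just out of reach of the ends of the black and the white
  -- part.
  · refine ⟨_, N + 1, h0, fun l hl => ?_⟩
    rw [h.isLoop_iff, walk_lineStep_of_lt _ _ _ _ (by omega), lineGraph_isLoop_iff false l (N + 1)]
    simp
  · refine ⟨_, -N - 2, h0, fun l hl => ?_⟩
    rw [h.isLoop_iff, walk_lineStep_of_lt_neg _ _ _ _ (by omega),
      lineGraph_isLoop_iff true l (-N - 2)]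
    simp

/-- A pointed graph with the closed walks of a finite word is a Schreier graph, with a base vertex
in the orbit of any given dyadic rational. -/
theorem exists_iso_rebase {Γ : PGraph} {u : ℕ → Bool} {j : ℤ} (hu : IsFiniteWord u)
    (h : ∀ l, Γ.IsLoop l ↔ walk (lineStep wordTree) l (u, j) = (u, j)) (q : DyadicPoint) :
    ∃ v : (schreierGraph q).V, Γ.Iso ((schreierGraph q).rebase v) := by
  obtain ⟨g, _, hg⟩ := q.exists_smul_eq (hu.dyadicPoint j)
  refine ⟨⟨wordPoint (u, j), g, hg⟩, PGraph.iso_of_isLoop_iff fun l => ?_⟩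
  rw [h, ← walk_genPerm_wordPoint_eq_iff l hu]
  exact (schreierGraph_rebase_isLoop_iff q ⟨wordPoint (u, j), g, hg⟩ l).symm

theorem exists_iso_of_mem_closure {Γ : PGraph} (h : Γ ∈ closure dyadicFamily) (q : DyadicPoint) :
    (∃ v : (schreierGraph q).V, Γ.Iso ((schreierGraph q).rebase v)) ∨
      (∃ w j, Γ.Iso (upwardGraph w j)) ∨ ∃ b, Γ.Iso (lineGraph b) := by
  rw [mem_closure_dyadicFamily_iff] at h
  choose u j hu h using h
  -- A nonprincipal ultrafilter replaces the successive choice of subsequences.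
  set 𝒰 : Ultrafilter ℕ := hyperfilter ℕ
  have hlarge (N : ℕ) : ∀ᶠ n in (𝒰 : Filter ℕ), N ≤ n :=
    Nat.hyperfilter_le_atTop (eventually_ge_atTop N)
  -- a word is closed in `Γ` iff it is closed at almost all the points
  have key {l : List (Fin 2 × Bool)} {P : Prop} (hP : ∀ᶠ n in (𝒰 : Filter ℕ),
      (walk (lineStep wordTree) l (u n, j n) = (u n, j n) ↔ P)) : Γ.IsLoop l ↔ P := by
    obtain ⟨n, h1, h2⟩ := (hP.and (hlarge l.length)).exists
    exact (h n l h2).trans h1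
  by_cases hj : ∃ k, ∀ᶠ n in (𝒰 : Filter ℕ), j n = k
  · obtain ⟨k, hk⟩ := hj
    -- the limit of the words
    have hw (i : ℕ) : ∃ a, ∀ᶠ n in (𝒰 : Filter ℕ), u n i = a := by
      by_cases ha : ∀ᶠ n in (𝒰 : Filter ℕ), u n i = true
      · exact ⟨true, ha⟩
      · refine ⟨false, (Ultrafilter.eventually_not.2 ha).mono fun n hn => by simpa using hn⟩
    choose w hw using hw
    have hpre (M : ℕ) : ∀ᶠ n in (𝒰 : Filter ℕ), ∀ i < M, u n i = w i :=
      (eventually_all_finite (finite_lt_nat M)).2 fun i _ => hw i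
    by_cases hm : ∃ m, ∀ᶠ n in (𝒰 : Filter ℕ), ∀ i, m ≤ i → u n i = false
    · obtain ⟨m, hm⟩ := hm
      left
      -- The first m letters converge and the others vanish, so almost all words equal that of a
      -- single index.
      obtain ⟨n₀, h1, h2, h3⟩ := (hpre m).and (hm.and hk) |>.exists
      refine exists_iso_rebase (hu n₀) (j := j n₀) (fun l => key ?_) q
      filter_upwards [hpre m, hm, hk] with n h1' h2' h3'
      have : u n = u n₀ := by
        funext i
        rcases lt_or_ge i m with hi | hi
        · rw [h1 i hi, h1' i hi]
        · rw [h2 i hi, h2' i hi]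
      rw [this, h3, h3']
    · right; left
      refine ⟨w, k, PGraph.iso_of_isLoop_iff fun l => key ?_⟩
      -- Almost every word has a 1 at or beyond |l|; as the word is finite, its last 1 is at least
      -- that deep.
      have hm' : ∀ᶠ n in (𝒰 : Filter ℕ), ¬ ∀ i, l.length ≤ i → u n i = false :=
        Ultrafilter.eventually_not.2 fun h => hm ⟨_, h⟩
      filter_upwards [hm', hpre (2 * l.length), hk] with n h1 h2 h3
      obtain ⟨m, hlm, hm⟩ : ∃ m, l.length ≤ m ∧ LastOne m (u n) := by
        classical
        obtain ⟨b, hb⟩ := hu n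
        push Not at h1
        obtain ⟨i, hi, hi'⟩ := h1
        have hib : i ≤ b := by
          by_contra hlt
          exact hi' (hb i (by omega))
        have hi1 : u n i = true := by simpa using hi'
        refine ⟨_, hi.trans (Nat.le_findGreatest (P := fun i => u n i = true) hib hi1),
          Nat.findGreatest_spec (P := fun i => u n i = true) hib hi1, fun i hi => ?_⟩
        rcases le_or_gt i b with hb' | hb'
        · simpa using Nat.findGreatest_is_greatest hi hb'
        · exact hb i hb'.le
      rw [h3, walk_wordTree_eq_iff hm hlm, upwardGraph_isLoop_iff]
      exact walk_levelTree_eq_iff_of_prefix k h2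
  · right; right
    push Not at hj
    -- Not being constant almost everywhere, the positions leave every finite set; their sign then
    -- selects the end.
    have hne (s : Set ℤ) (hs : s.Finite) : ∀ᶠ n in (𝒰 : Filter ℕ), j n ∉ s := by
      have : ∀ᶠ n in (𝒰 : Filter ℕ), ∀ k ∈ s, j n ≠ k :=
        (eventually_all_finite hs).2 fun k _ => hj k
      exact this.mono fun n hn hmem => hn _ hmem rfl
    by_cases hpos : ∀ᶠ n in (𝒰 : Filter ℕ), 0 ≤ j n
    · refine ⟨false, PGraph.iso_of_isLoop_iff fun l => key ?_⟩
      filter_upwards [hpos, hne _ (finite_Icc 0 (l.length : ℤ))] with n h1 h2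
      rw [mem_Icc] at h2
      rw [walk_lineStep_of_lt _ _ _ _ (by omega), lineGraph_isLoop_iff false l (j n)]
      simp
    · refine ⟨true, PGraph.iso_of_isLoop_iff fun l => key ?_⟩
      filter_upwards [Ultrafilter.eventually_not.2 hpos,
        hne _ (finite_Icc (-(l.length : ℤ) - 1) 0)] with n h1 h2
      rw [mem_Icc] at h2
      rw [walk_lineStep_of_lt_neg _ _ _ _ (by omega), lineGraph_isLoop_iff true l (j n)]
      simp

/-! ### Limit graphs with different labels are not isomorphic -/

theorem exists_walk_lineStep_add {U : Type*} (e : Bool × U ≃ U) (k : ℤ) :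
    ∃ m, ∀ x : U × ℤ, walk (lineStep e) m x = (x.1, x.2 + k) := by
  induction k using Int.induction_on with
  | zero => exact ⟨[], fun x => by simp⟩
  | succ k ih =>
    obtain ⟨m, hm⟩ := ih
    exact ⟨m ++ [(0, true)], fun x => by
      rw [walk_append, hm, ← add_assoc]
      rfl⟩
  | pred k ih =>
    obtain ⟨m, hm⟩ := ih
    exact ⟨m ++ [(0, false)], fun x => by
      rw [walk_append, hm, ← add_sub_assoc]
      rfl⟩

/-- Only the black vertices are fixed by `x₁`. -/
theorem lineStep_levelTree_one_eq_iff (x : ((ℕ → Bool) × ℤ) × ℤ) :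
    lineStep levelTree 1 x = x ↔ 1 ≤ x.2 := by
  obtain ⟨⟨u, k⟩, j⟩ := x
  rw [lineStep_one_apply]
  split_ifs with h <;> simp_all [levelTree_apply]

/-- The word labels a walk from the base vertex to a vertex with a loop labeled by `x₁`. -/
def PGraph.LoopAfter (Γ : PGraph) (m : List (Fin 2 × Bool)) : Prop :=
  Γ.IsLoop ((m ++ [(1, true)]) ++ invWord m)

theorem PGraph.Iso.loopAfter_iff {Γ Δ : PGraph} (h : Γ.Iso Δ) (m : List (Fin 2 × Bool)) :
    Γ.LoopAfter m ↔ Δ.LoopAfter m := h.isLoop_iff _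

theorem upwardGraph_loopAfter_iff (w : ℕ → Bool) (j : ℤ) (m : List (Fin 2 × Bool)) :
    (upwardGraph w j).LoopAfter m ↔ 1 ≤ (walk (lineStep levelTree) m ((w, 0), j)).2 := by
  rw [PGraph.LoopAfter, upwardGraph_isLoop_iff, walk_append_invWord_eq_iff, walk_append]
  exact lineStep_levelTree_one_eq_iff _

theorem lineGraph_loopAfter_iff (b : Bool) (m : List (Fin 2 × Bool)) :
    (lineGraph b).LoopAfter m ↔ b = false := by
  rw [PGraph.LoopAfter, lineGraph_isLoop_iff b _ 0, walk_append_invWord_eq_iff, walk_append]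
  change linePerm b 1 _ = _ ↔ _
  rw [linePerm_apply]
  split_ifs with h <;> simp_all

/-- Black vertices determine the word and the position. -/
theorem eq_of_forall_walk_levelTree {x y : ((ℕ → Bool) × ℤ) × ℤ}
    (h : ∀ m, 1 ≤ (walk (lineStep levelTree) m x).2 ↔ 1 ≤ (walk (lineStep levelTree) m y).2) :
    x.1.1 = y.1.1 ∧ x.2 = y.2 := by
  have hpos {x y : ((ℕ → Bool) × ℤ) × ℤ} (h : ∀ m, 1 ≤ (walk (lineStep levelTree) m x).2 ↔
      1 ≤ (walk (lineStep levelTree) m y).2) : x.2 = y.2 := by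
    -- The powers of x₀ that bring x and y to position 1, the first black vertex, give the two
    -- inequalities between the positions.
    obtain ⟨m, hm⟩ := exists_walk_lineStep_add levelTree (1 - x.2)
    obtain ⟨m', hm'⟩ := exists_walk_lineStep_add levelTree (1 - y.2)
    have h1 := h m
    have h2 := h m'
    simp only [hm, hm'] at h1 h2
    omega
  refine ⟨funext fun i => ?_, hpos h⟩
  induction i generalizing x y with
  | zero =>
    -- From the grey vertex, x₁⁻¹ leads to position 0 or -1 of the parent's line according to the
    -- first letter, and `hpos` compares these positions.
    obtain ⟨m, hm⟩ := exists_walk_lineStep_add levelTree (-x.2)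
    have h1 := hpos (x := walk (lineStep levelTree) (m ++ [(1, false)]) x)
      (y := walk (lineStep levelTree) (m ++ [(1, false)]) y) fun m' => by
        rw [← walk_append, ← walk_append]
        exact h _
    rw [walk_append, walk_append, hm, hm, hpos h, add_neg_cancel] at h1
    simp only [walk, cond_false, lineStep_one_symm_apply] at h1
    rcases x with ⟨⟨u, k⟩, j⟩
    rcases y with ⟨⟨v, k'⟩, j'⟩
    simp only [levelTree_symm_apply] at h1 ⊢
    cases hu : u 0 <;> cases hv : v 0 <;> simp [hu, hv] at h1 ⊢
  | succ i ih =>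
    obtain ⟨m, hm⟩ := exists_walk_lineStep_add levelTree (-x.2)
    -- The same walk ends on the line of the parent, whose word is the tail.
    have h1 := ih (x := walk (lineStep levelTree) (m ++ [(1, false)]) x)
      (y := walk (lineStep levelTree) (m ++ [(1, false)]) y) fun m' => by
        rw [← walk_append, ← walk_append]
        exact h _
    rw [walk_append, walk_append, hm, hm, hpos h, add_neg_cancel] at h1
    exact h1

theorem eq_of_upwardGraph_iso {w w' : ℕ → Bool} {j j' : ℤ}
    (h : (upwardGraph w j).Iso (upwardGraph w' j')) : w = w' ∧ j = j' :=
  eq_of_forall_walk_levelTree (x := ((w, 0), j)) (y := ((w', 0), j')) fun m => by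
    rw [← upwardGraph_loopAfter_iff, ← upwardGraph_loopAfter_iff, h.loopAfter_iff]

/-- Position 1 of a line carries an x₁-loop and position 0 does not, whereas in a line graph all
vertices look alike. -/
theorem not_iso_upwardGraph_lineGraph (w : ℕ → Bool) (j : ℤ) (b : Bool) :
    ¬ (upwardGraph w j).Iso (lineGraph b) := by
  intro h
  obtain ⟨m, hm⟩ := exists_walk_lineStep_add levelTree (1 - j)
  obtain ⟨m', hm'⟩ := exists_walk_lineStep_add levelTree (-j)
  have h1 := h.loopAfter_iff m
  have h2 := h.loopAfter_iff m'
  rw [upwardGraph_loopAfter_iff, lineGraph_loopAfter_iff] at h1 h2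
  rw [← h1, hm, hm'] at h2
  simp at h2

theorem PGraph.Iso.symm {Γ Δ : PGraph} (h : Γ.Iso Δ) : Δ.Iso Γ :=
  iso_of_isLoop_iff fun l => (h.isLoop_iff l).symm

theorem eq_const_or_eq_blockWord (ξ : ℕ → Bool) :
    (∃ a, ξ = fun _ => a) ∨ ∃ a n w, 1 ≤ n ∧ ξ = blockWord a n w := by
  classical
  by_cases h : ∃ n, ξ n ≠ ξ 0
  · right
    have hs := Nat.find_spec h
    refine ⟨ξ 0, Nat.find h, fun i => ξ (Nat.find h + 1 + i), ?_, funext fun i => ?_⟩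
    · by_contra hn
      rw [show Nat.find h = 0 by omega] at hs
      exact hs rfl
    · unfold blockWord
      split_ifs with h1 h2
      · simpa using Nat.find_min h h1
      · rw [h2]
        revert hs
        cases ξ (Nat.find h) <;> cases ξ 0 <;> simp
      · congr 1
        omega
  · left
    push Not at h
    exact ⟨ξ 0, funext h⟩

theorem eq_of_limitGraph_iso {ξ η : ℕ → Bool} (h : (limitGraph ξ).Iso (limitGraph η)) :
    ξ = η := by
  rcases eq_const_or_eq_blockWord ξ with ⟨a, rfl⟩ | ⟨a, n, w, hn, rfl⟩ <;>
    rcases eq_const_or_eq_blockWord η with ⟨b, rfl⟩ | ⟨b, m, w', hm, rfl⟩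
  · rw [limitGraph_const, limitGraph_const] at h
    have := h.loopAfter_iff []
    rw [lineGraph_loopAfter_iff, lineGraph_loopAfter_iff] at this
    have hab : a = b := by revert this; cases a <;> cases b <;> simp
    rw [hab]
  · rw [limitGraph_const, limitGraph_blockWord _ _ hm] at h
    exact absurd h.symm (not_iso_upwardGraph_lineGraph _ _ _)
  · rw [limitGraph_const, limitGraph_blockWord _ _ hn] at h
    exact absurd h (not_iso_upwardGraph_lineGraph _ _ _)
  · rw [limitGraph_blockWord _ _ hn, limitGraph_blockWord _ _ hm] at h
    obtain ⟨rfl, h2⟩ := eq_of_upwardGraph_iso h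
    -- The position is 1 - n ≤ 0 for a = 1 and n ≥ 1 for a = 0, so its sign gives the first letter
    -- and its value the block length.
    have : a = b ∧ n = m := by
      revert h2
      cases a <;> cases b <;> simp <;> omega
    rw [this.1, this.2]

end ThompsonSchreier

theorem mainTheorem5 :
    (∀ Γ : ThompsonSchreier.PGraph, Γ ∈ closure ThompsonSchreier.dyadicFamily ↔
      (∃ v : (ThompsonSchreier.schreierGraph ThompsonSchreier.DyadicPoint.half).V,
        Γ.Iso ((ThompsonSchreier.schreierGraph ThompsonSchreier.DyadicPoint.half).rebase v)) ∨
      (∃ (n : ℕ) (w : ℕ → Bool), 1 ≤ n ∧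
        (Γ.Iso (ThompsonSchreier.limitGraph (ThompsonSchreier.blockWord true n w)) ∨
          Γ.Iso (ThompsonSchreier.limitGraph (ThompsonSchreier.blockWord false n w)))) ∨
      (Γ.Iso (ThompsonSchreier.lineGraph false) ∨ Γ.Iso (ThompsonSchreier.lineGraph true))) ∧
    (∀ ξ η : ℕ → Bool,
      (ThompsonSchreier.limitGraph ξ).Iso (ThompsonSchreier.limitGraph η) → ξ = η) := by
  open ThompsonSchreier in
  refine ⟨fun Γ => ⟨fun h => ?_, ?_⟩, fun ξ η => eq_of_limitGraph_iso⟩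
  · rcases exists_iso_of_mem_closure h DyadicPoint.half with h | ⟨w, j, h⟩ | ⟨b, h⟩
    · exact Or.inl h
    · right; left
      -- Every position on the line arises from exactly one block: black ones from 0^j 1 w, the
      -- others from 1^(1-j) 0 w.
      rcases le_or_gt 1 j with hj | hj
      · refine ⟨j.toNat, w, by omega, Or.inr ?_⟩
        rw [limitGraph_blockWord _ _ (by omega), if_neg (by simp), Int.toNat_of_nonneg (by omega)]
        exact h
      · refine ⟨(1 - j).toNat, w, by omega, Or.inl ?_⟩
        rw [limitGraph_blockWord _ _ (by omega), if_pos rfl, Int.toNat_of_nonneg (by omega),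
          sub_sub_cancel]
        exact h
    · right; right
      cases b
      · exact Or.inl h
      · exact Or.inr h
  · rintro (⟨v, h⟩ | ⟨n, w, hn, h | h⟩ | h | h)
    · exact mem_closure_of_iso_rebase h
    · rw [limitGraph_blockWord _ _ hn] at h
      exact mem_closure_of_iso_upwardGraph h
    · rw [limitGraph_blockWord _ _ hn] at h
      exact mem_closure_of_iso_upwardGraph h
    · exact mem_closure_of_iso_lineGraph h
    · exact mem_closure_of_iso_lineGraph h
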